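/- Let $K$ be a field of characteristic $0$. A \emph{$2$-vector space} over $K$ is a category object in the category of $K$-vector spaces (source $s$, target $t$, object inclusion $x\mapsto 1_x$, linear composition); its associated $2$-term complex is $d=t|_{\ker s}:\ker s\to L_0$, and the \emph{arrow part} of an arrow $f$ is $\vec f=f-1_{s(f)}\in\ker s$. A \emph{semi-strict Lie $2$-algebra} is a $2$-vector space $L$ with a skew-symmetric bilinear functor $[\cdot,\cdot]:L\times L\to L$ and a trilinear natural isomorphism $J_{x,y,z}:[[x,y],z]\to[x,[y,z]]+[[x,z],y]$, with completely antisymmetric arrow part, satisfying the Jacobiator identity of Baez and Crans. With the morphisms of Baez and Crans (linear functors $F$ together with skew-symmetric bilinear natural transformations $[Fx,Fy]\to F[x,y]$ compatible with the Jacobiators) and their $2$-morphisms (compatible linear natural transformations) these form a strict $2$-category $\mathtt{ssLie2}$. A \emph{strict Lie $2$-algebra} is a category object in Lie algebras over $K$; it is regarded as a semi-strict Lie $2$-algebra with identity Jacobiator. A crossed module of Lie algebras $\mu:\mathfrak h\to\mathfrak g$ gives a strict Lie $2$-algebra with objects $\mathfrak g$, arrows $\mathfrak h\rtimes\mathfrak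 g$, $s(h,g)=g$, $t(h,g)=\mu(h)+g$, $1_g=(0,g)$. A semi-strict Lie $2$-algebra $S$ is \emph{skeletal} if $d=0$. It then determines a triple $(\bar{\mathfrak g},V,[l_3])$: the Lie algebra $\bar{\mathfrak g}=S_0$, the $\bar{\mathfrak g}$-module $V=\ker s$ with $x\cdot v=[1_x,v]$, and the class in $H^3(\bar{\mathfrak g},V)$ of $l_3(x,y,z)=\vec J_{x,y,z}$. A \emph{skeletal model} of $L$ is a skeletal $S$ with an equivalence $F:S\to L$ in $\mathtt{ssLie2}$ that is, on objects, a section of a quotient map $L_0\to S_0$ with kernel $\operatorname{im}d$, and maps $\ker s_S$ bijectively onto $\ker d$. A crossed module $\mu:\mathfrak h\to\mathfrak g$ determines the triple $(\operatorname{coker}\mu,\ker\mu,[\gamma])$, where $\gamma=d_{CE}\varphi$ for a linear section $\sigma$ of $\mathfrak g\to\operatorname{coker}\mu$ and a skew-symmetric bilinear $\varphi:\operatorname{coker}\mu\times\operatorname{coker}\mu\to\mathfrak h$ with $\mu\varphi(x,y)=\sigma[x,y]-[\sigma x,\sigma y]$; here $d_{CE}$ is the Chevalley--Eilenberg formula with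 $x$ acting on $\mathfrak h$ through $\sigma(x)$. It \emph{realizes} the triple of $S$ if the two triples are isomorphic. \textbf{Statement.} Let $L$ be a semi-strict Lie $2$-algebra over $K$. \begin{enumerate} \item $L$ is equivalent, as an object of the $2$-category $\mathtt{ssLie2}$, to a strict Lie $2$-algebra. \item $L$ has a skeletal model. \item For every skeletal model $S$ of $L$, there is a crossed module of Lie algebras which realizes the triple $(\bar{\mathfrak g},V,[l_3])$ of $S$; and for every such crossed module, $L$ is equivalent in $\mathtt{ssLie2}$ to the strict Lie $2$-algebra of that crossed module. \end{enumerate} -/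

import Mathlib

universe u v

open CategoryTheory

/-- A `2`-vector space over `K`: a category object in the category of `K`-vector spaces.
`comp f g h` is the composite "first `f`, then `g`" of the composable pair `(f, g)`; the fields
`comp_add` and `comp_smul` say that it is linear on the pullback `Arr ×_Obj Arr`. -/
structure TwoVectorSpace (K : Type u) [Field K] where
  Obj : Type v
  Arr : Type v
  [addCommGroupObj : AddCommGroup Obj]
  [moduleObj : Module K Obj]
  [addCommGroupArr : AddCommGroup Arr]
  [moduleArr : Module K Arr]
  src : Arr →ₗ[K] Obj
  tgt : Arr →ₗ[K] Obj
  idn : Obj →ₗ[K] Arr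
  comp : (f g : Arr) → tgt f = src g → Arr
  src_idn : ∀ x, src (idn x) = x
  tgt_idn : ∀ x, tgt (idn x) = x
  src_comp : ∀ f g h, src (comp f g h) = src f
  tgt_comp : ∀ f g h, tgt (comp f g h) = tgt g
  comp_add : ∀ (f g f' g' : Arr) (h : tgt f = src g) (h' : tgt f' = src g'),
    comp (f + f') (g + g') (by rw [map_add, map_add, h, h']) = comp f g h + comp f' g' h'
  comp_smul : ∀ (c : K) (f g : Arr) (h : tgt f = src g),
    comp (c • f) (c • g) (by rw [map_smul, map_smul, h]) = c • comp f g h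
  idn_comp : ∀ f, comp (idn (src f)) f (tgt_idn _) = f
  comp_idn : ∀ f, comp f (idn (tgt f)) (src_idn _).symm = f
  comp_assoc : ∀ (f g k : Arr) (h : tgt f = src g) (h' : tgt g = src k),
    comp (comp f g h) k ((tgt_comp f g h).trans h') =
      comp f (comp g k h') (h.trans (src_comp g k h').symm)

attribute [instance] TwoVectorSpace.addCommGroupObj TwoVectorSpace.moduleObj
  TwoVectorSpace.addCommGroupArr TwoVectorSpace.moduleArr

attribute [simp] TwoVectorSpace.src_idn TwoVectorSpace.tgt_idn TwoVectorSpace.src_comp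
  TwoVectorSpace.tgt_comp

namespace TwoVectorSpace

variable {K : Type u} [Field K] (L : TwoVectorSpace.{u, v} K)

/-- The composition is determined by source, target and object inclusion. -/
theorem comp_eq (f g : L.Arr) (h : L.tgt f = L.src g) :
    L.comp f g h = f + g - L.idn (L.tgt f) := by
  have h2 : L.tgt 0 = L.src (g - L.idn (L.tgt f)) := by simp [h]
  have key := L.comp_add f (L.idn (L.tgt f)) 0 (g - L.idn (L.tgt f)) (L.src_idn _).symm h2
  have h3 : L.comp 0 (g - L.idn (L.tgt f)) h2 = g - L.idn (L.tgt f) := by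
    have h4 := L.idn_comp (g - L.idn (L.tgt f))
    have h5 : L.idn (L.src (g - L.idn (L.tgt f))) = 0 := by rw [← h2]; simp
    simpa only [h5] using h4
  rw [h3, L.comp_idn] at key
  simp only [add_zero, add_sub_cancel] at key
  rw [key]; abel

/-- Every arrow is invertible. -/
theorem exists_inverse (f : L.Arr) : ∃ (g : L.Arr) (h : L.tgt f = L.src g)
    (h' : L.tgt g = L.src f), L.comp f g h = L.idn (L.src f) ∧ L.comp g f h' = L.idn (L.tgt f) := by
  refine ⟨L.idn (L.src f) + L.idn (L.tgt f) - f, by simp, by simp, ?_, ?_⟩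
  · rw [L.comp_eq]; abel
  · rw [L.comp_eq]; simp

/-- The arrow part `f - i(s(f))` of an arrow `f`, an element of `ker s`. -/
def arrowPart : L.Arr →ₗ[K] LinearMap.ker L.src :=
  LinearMap.codRestrict _ (LinearMap.id - L.idn ∘ₗ L.src) (fun f => by simp)

@[simp] theorem coe_arrowPart (f : L.Arr) : (L.arrowPart f : L.Arr) = f - L.idn (L.src f) := rfl

/-- The differential `d = t|_{ker s}` of the associated `2`-term complex `ker s → Obj`. -/
def diff : LinearMap.ker L.src →ₗ[K] L.Obj := L.tgt ∘ₗ (LinearMap.ker L.src).subtype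

end TwoVectorSpace

/-- A `2`-vector space with a skew-symmetric bilinear functor `L × L → L` (the bracket) and a
trilinear family of arrows `jac x y z : [[x,y],z] → [x,[y,z]] + [[x,z],y]`. -/
structure PreLie2Algebra (K : Type u) [Field K] extends TwoVectorSpace.{u, v} K where
  brObj : Obj →ₗ[K] Obj →ₗ[K] Obj
  brArr : Arr →ₗ[K] Arr →ₗ[K] Arr
  src_brArr : ∀ f g, src (brArr f g) = brObj (src f) (src g)
  tgt_brArr : ∀ f g, tgt (brArr f g) = brObj (tgt f) (tgt g)
  brArr_idn : ∀ x y, brArr (idn x) (idn y) = idn (brObj x y)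
  brArr_comp : ∀ (f f' g g' : Arr) (h : tgt f = src f') (h' : tgt g = src g'),
    brArr (comp f f' h) (comp g g' h') =
      comp (brArr f g) (brArr f' g') (by rw [tgt_brArr, src_brArr, h, h'])
  brObj_skew : ∀ x y, brObj x y = - brObj y x
  brArr_skew : ∀ f g, brArr f g = - brArr g f
  jac : Obj →ₗ[K] Obj →ₗ[K] Obj →ₗ[K] Arr
  src_jac : ∀ x y z, src (jac x y z) = brObj (brObj x y) z
  tgt_jac : ∀ x y z, tgt (jac x y z) = brObj x (brObj y z) + brObj (brObj x z) y

attribute [simp] PreLie2Algebra.src_brArr PreLie2Algebra.tgt_brArr PreLie2Algebra.brArr_idn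
  PreLie2Algebra.src_jac PreLie2Algebra.tgt_jac

/-- The axioms on the Jacobiator in a semi-strict Lie `2`-algebra: it is a natural transformation,
its arrow part is completely antisymmetric, and it satisfies the Jacobiator identity, i.e. the two
composites
`[[[w,x],y],z] → [[[w,z],y],x] + [[w,[y,z]],x] + [[w,y],[x,z]] + [w,[[x,z],y]] + [w,[x,[y,z]]]
+ [[w,z],[x,y]]` agree. -/
structure PreLie2Algebra.IsSemistrict {K : Type u} [Field K] (L : PreLie2Algebra.{u, v} K) :
    Prop where
  jac_natural : ∀ f g k : L.Arr,
    L.comp (L.brArr (L.brArr f g) k) (L.jac (L.tgt f) (L.tgt g) (L.tgt k)) (by simp) =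
      L.comp (L.jac (L.src f) (L.src g) (L.src k))
        (L.brArr f (L.brArr g k) + L.brArr (L.brArr f k) g) (by simp)
  jac_antisymm_left : ∀ x y z, L.arrowPart (L.jac x y z) = - L.arrowPart (L.jac y x z)
  jac_antisymm_right : ∀ x y z, L.arrowPart (L.jac x y z) = - L.arrowPart (L.jac x z y)
  jacobiator_identity : ∀ w x y z : L.Obj,
    L.comp
      (L.comp (L.jac (L.brObj w x) y z)
        (L.brArr (L.jac w x z) (L.idn y) + L.idn (L.brObj (L.brObj w x) (L.brObj y z)))
        (by simp; abel))
      (L.jac w (L.brObj x z) y + L.jac (L.brObj w z) x y + L.jac w x (L.brObj y z))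
      (by simp)
    =
    L.comp
      (L.comp
        (L.comp (L.brArr (L.jac w x y) (L.idn z))
          (L.jac (L.brObj w y) x z + L.jac w (L.brObj x y) z)
          (by simp; abel))
        (L.brArr (L.jac w y z) (L.idn x) + L.idn (L.brObj (L.brObj w y) (L.brObj x z) +
          L.brObj w (L.brObj (L.brObj x y) z) + L.brObj (L.brObj w z) (L.brObj x y)))
        (by simp; abel))
      (L.brArr (L.idn w) (L.jac x y z) + L.idn (L.brObj (L.brObj w (L.brObj y z)) x +
        L.brObj (L.brObj (L.brObj w z) y) x + L.brObj (L.brObj w y) (L.brObj x z) +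
        L.brObj (L.brObj w z) (L.brObj x y)))
      (by simp; abel)

/-- The axioms on the Jacobiator hold if it is the identity and the bracket on arrows satisfies the
Jacobi identity. -/
theorem PreLie2Algebra.isSemistrict_of_jac_eq_idn {K : Type u} [Field K]
    (L : PreLie2Algebra.{u, v} K)
    (hj : ∀ x y z, L.jac x y z = L.idn (L.brObj (L.brObj x y) z))
    (hl : ∀ f g k, L.brArr (L.brArr f g) k = L.brArr f (L.brArr g k) + L.brArr (L.brArr f k) g) :
    L.IsSemistrict := by
  have ha : ∀ x y z, L.arrowPart (L.jac x y z) = 0 := fun x y z => by ext; simp [hj]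
  have hcomp : ∀ f g h, (∃ a, g = L.idn a) → L.comp f g h = f := by
    rintro f _ h ⟨a, rfl⟩
    rw [TwoVectorSpace.comp_eq, h]; simp
  refine ⟨fun f g k => ?_, fun x y z => ?_, fun x y z => ?_, fun w x y z => ?_⟩
  · simp only [TwoVectorSpace.comp_eq, hj]
    simp
    exact hl f g k
  · rw [ha, ha, neg_zero]
  · rw [ha, ha, neg_zero]
  · refine ((hcomp _ _ _ ?_).trans (hcomp _ _ _ ?_)).trans
      (((hcomp _ _ _ ?_).trans ((hcomp _ _ _ ?_).trans (hcomp _ _ _ ?_))).trans ?_).symm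
    on_goal 6 => simp [hj]
    all_goals simp only [hj, PreLie2Algebra.brArr_idn, ← map_add]; exact ⟨_, rfl⟩

/-- A semi-strict Lie `2`-algebra over `K`: a `2`-vector space with a skew-symmetric bilinear
functorial bracket and a completely antisymmetric trilinear natural isomorphism (every arrow of a
`2`-vector space is invertible) `[[x,y],z] → [x,[y,z]] + [[x,z],y]`, the Jacobiator, which
satisfies the Jacobiator identity. -/
structure SemistrictLie2Algebra (K : Type u) [Field K] extends PreLie2Algebra.{u, v} K where
  isSemistrict : toPreLie2Algebra.IsSemistrict

namespace SemistrictLie2Algebra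

variable {K : Type u} [Field K]

/-- A morphism of semi-strict Lie `2`-algebras: a linear functor together with a skew-symmetric
bilinear natural transformation `map₂ x y : [F x, F y] → F [x, y]` compatible with the
Jacobiators. -/
@[ext]
structure Hom (L M : SemistrictLie2Algebra.{u, v} K) where
  obj : L.Obj →ₗ[K] M.Obj
  arr : L.Arr →ₗ[K] M.Arr
  src_arr : ∀ f, M.src (arr f) = obj (L.src f)
  tgt_arr : ∀ f, M.tgt (arr f) = obj (L.tgt f)
  arr_idn : ∀ x, arr (L.idn x) = M.idn (obj x)
  arr_comp : ∀ (f g : L.Arr) (h : L.tgt f = L.src g),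
    arr (L.comp f g h) = M.comp (arr f) (arr g) (by rw [src_arr, tgt_arr, h])
  map₂ : L.Obj →ₗ[K] L.Obj →ₗ[K] M.Arr
  src_map₂ : ∀ x y, M.src (map₂ x y) = M.brObj (obj x) (obj y)
  tgt_map₂ : ∀ x y, M.tgt (map₂ x y) = obj (L.brObj x y)
  map₂_natural : ∀ f g : L.Arr,
    M.comp (M.brArr (arr f) (arr g)) (map₂ (L.tgt f) (L.tgt g))
        (by simp [tgt_arr, src_map₂]) =
      M.comp (map₂ (L.src f) (L.src g)) (arr (L.brArr f g)) (by simp [src_arr, tgt_map₂])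
  map₂_skew : ∀ x y, map₂ x y = - map₂ y x
  map₂_jac : ∀ x y z : L.Obj,
    M.comp
      (M.comp (M.brArr (map₂ x y) (M.idn (obj z))) (map₂ (L.brObj x y) z)
        (by simp [tgt_map₂, src_map₂]))
      (arr (L.jac x y z)) (by simp [tgt_map₂, src_arr])
    =
    M.comp
      (M.comp (M.jac (obj x) (obj y) (obj z))
        (M.brArr (M.idn (obj x)) (map₂ y z) + M.brArr (map₂ x z) (M.idn (obj y)))
        (by simp [src_map₂]))
      (map₂ x (L.brObj y z) + map₂ (L.brObj x z) y) (by simp [tgt_map₂, src_map₂])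

attribute [simp] Hom.src_arr Hom.tgt_arr Hom.arr_idn Hom.src_map₂ Hom.tgt_map₂

/-- A `2`-morphism `F ⇒ G`: a linear natural transformation compatible with `F.map₂` and
`G.map₂`. -/
@[ext]
structure Hom₂ {L M : SemistrictLie2Algebra.{u, v} K} (F G : Hom L M) where
  app : L.Obj →ₗ[K] M.Arr
  src_app : ∀ x, M.src (app x) = F.obj x
  tgt_app : ∀ x, M.tgt (app x) = G.obj x
  natural : ∀ f : L.Arr,
    M.comp (F.arr f) (app (L.tgt f)) (by simp [src_app]) =
      M.comp (app (L.src f)) (G.arr f) (by simp [tgt_app])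
  app_br : ∀ x y : L.Obj,
    M.comp (F.map₂ x y) (app (L.brObj x y)) (by simp [src_app]) =
      M.comp (M.brArr (app x) (app y)) (G.map₂ x y) (by simp [tgt_app])

attribute [simp] Hom₂.src_app Hom₂.tgt_app

section Bicategory

variable {L M N P : SemistrictLie2Algebra.{u, v} K}

/-- The identity morphism. -/
def Hom.id (L : SemistrictLie2Algebra.{u, v} K) : Hom L L where
  obj := LinearMap.id
  arr := LinearMap.id
  src_arr _ := rfl
  tgt_arr _ := rfl
  arr_idn _ := rfl
  arr_comp _ _ _ := rfl
  map₂ := L.brObj.compr₂ L.idn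
  src_map₂ := by simp
  tgt_map₂ := by simp
  map₂_natural f g := by simp [L.comp_eq]
  map₂_skew x y := by
    rw [LinearMap.compr₂_apply, LinearMap.compr₂_apply, L.brObj_skew x y, map_neg]
  map₂_jac x y z := by
    simp only [L.comp_eq]
    simp

/-- The composite "first `F`, then `G`"; its third component is
`[G F x, G F y] → G [F x, F y] → G F [x, y]`. -/
def Hom.comp (F : Hom L M) (G : Hom M N) : Hom L N where
  obj := G.obj ∘ₗ F.obj
  arr := G.arr ∘ₗ F.arr
  src_arr _ := by simp
  tgt_arr _ := by simp
  arr_idn _ := by simp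
  arr_comp f g h := by simp [F.arr_comp, G.arr_comp]
  map₂ := LinearMap.mk₂ K
    (fun x y => N.comp (G.map₂ (F.obj x) (F.obj y)) (G.arr (F.map₂ x y)) (by simp))
    (fun x x' y => by simp only [N.comp_eq]; simp; abel)
    (fun c x y => by simp only [N.comp_eq]; simp; module)
    (fun x x' y => by simp only [N.comp_eq]; simp; abel)
    (fun c x y => by simp only [N.comp_eq]; simp; module)
  src_map₂ := by simp
  tgt_map₂ := by simp
  map₂_natural f g := by
    have h1 := G.map₂_natural (F.arr f) (F.arr g)
    have h2 := congrArg G.arr (F.map₂_natural f g)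
    simp only [M.comp_eq, N.comp_eq] at h1 h2
    simp only [N.comp_eq, LinearMap.mk₂_apply, LinearMap.comp_apply]
    simp at h1 h2 ⊢
    linear_combination (norm := module) h1 + h2
  map₂_skew x y := by
    simp only [N.comp_eq, LinearMap.mk₂_apply]
    rw [G.map₂_skew, F.map₂_skew]
    simp
    rw [M.brObj_skew]
    simp
    abel
  map₂_jac x y z := by
    have h1 := G.map₂_jac (F.obj x) (F.obj y) (F.obj z)
    have h2 := congrArg G.arr (F.map₂_jac x y z)
    have h3 := G.map₂_natural (F.map₂ x y) (M.idn (F.obj z))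
    have h4 := G.map₂_natural (M.idn (F.obj x)) (F.map₂ y z)
    have h5 := G.map₂_natural (F.map₂ x z) (M.idn (F.obj y))
    simp only [M.comp_eq, N.comp_eq] at h1 h2 h3 h4 h5
    simp only [N.comp_eq, LinearMap.mk₂_apply, LinearMap.comp_apply]
    simp at h1 h2 h3 h4 h5 ⊢
    linear_combination (norm := module) h1 + h2 + h3 - h4 - h5

/-- The identity `2`-morphism. -/
def Hom₂.id (F : Hom L M) : Hom₂ F F where
  app := M.idn ∘ₗ F.obj
  src_app := by simp
  tgt_app := by simp
  natural f := by simp [M.comp_eq]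
  app_br x y := by simp [M.comp_eq]

/-- The vertical composite of `2`-morphisms. -/
def Hom₂.vcomp {F G H : Hom L M} (θ : Hom₂ F G) (η : Hom₂ G H) : Hom₂ F H where
  app :=
    { toFun := fun x => M.comp (θ.app x) (η.app x) (by simp)
      map_add' := fun x y => by simp only [M.comp_eq]; simp; abel
      map_smul' := fun c x => by simp only [M.comp_eq]; simp; module }
  src_app := by simp
  tgt_app := by simp
  natural f := by
    have h1 := θ.natural f
    have h2 := η.natural f
    simp only [M.comp_eq] at h1 h2
    simp only [M.comp_eq, LinearMap.coe_mk, AddHom.coe_mk]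
    simp at h1 h2 ⊢
    linear_combination (norm := module) h1 + h2
  app_br x y := by
    have h1 := θ.app_br x y
    have h2 := η.app_br x y
    have h3 := M.brArr_comp (θ.app x) (η.app x) (θ.app y) (η.app y) (by simp) (by simp)
    simp only [M.comp_eq] at h1 h2 h3
    simp only [M.comp_eq, LinearMap.coe_mk, AddHom.coe_mk]
    rw [h3]
    simp at h1 h2 ⊢
    linear_combination (norm := module) h1 + h2

/-- Left whiskering: `(F ◁ η) x = η (F x)`. -/
def Hom₂.whiskerLeft (F : Hom L M) {G H : Hom M N} (η : Hom₂ G H) :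
    Hom₂ (F.comp G) (F.comp H) where
  app := η.app ∘ₗ F.obj
  src_app := by simp [Hom.comp]
  tgt_app := by simp [Hom.comp]
  natural f := by
    have h1 := η.natural (F.arr f)
    simp only [N.comp_eq] at h1 ⊢
    simp [Hom.comp] at h1 ⊢
    exact h1
  app_br x y := by
    have h1 := η.app_br (F.obj x) (F.obj y)
    have h2 := η.natural (F.map₂ x y)
    simp only [N.comp_eq] at h1 h2 ⊢
    simp [Hom.comp, N.comp_eq] at h1 h2 ⊢
    linear_combination (norm := module) h1 + h2

/-- Right whiskering: `(θ ▷ H) x = H (θ x)`. -/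
def Hom₂.whiskerRight {F G : Hom L M} (θ : Hom₂ F G) (H : Hom M N) :
    Hom₂ (F.comp H) (G.comp H) where
  app := H.arr ∘ₗ θ.app
  src_app := by simp [Hom.comp]
  tgt_app := by simp [Hom.comp]
  natural f := by
    have h1 := congrArg H.arr (θ.natural f)
    simp only [M.comp_eq, N.comp_eq] at h1 ⊢
    simp [Hom.comp] at h1 ⊢
    exact h1
  app_br x y := by
    have h1 := congrArg H.arr (θ.app_br x y)
    have h2 := H.map₂_natural (θ.app x) (θ.app y)
    simp only [M.comp_eq, N.comp_eq] at h1 h2 ⊢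
    simp [Hom.comp, N.comp_eq] at h1 h2 ⊢
    linear_combination (norm := module) h1 - h2

theorem Hom.comp_assoc (F : Hom L M) (G : Hom M N) (H : Hom N P) :
    (F.comp G).comp H = F.comp (G.comp H) := by
  refine Hom.ext rfl rfl ?_
  ext x y
  simp [Hom.comp, N.comp_eq, P.comp_eq]
  abel

theorem Hom.id_comp (F : Hom L M) : (Hom.id L).comp F = F := by
  refine Hom.ext rfl rfl ?_
  ext x y
  simp [Hom.comp, Hom.id, M.comp_eq]

theorem Hom.comp_id (F : Hom L M) : F.comp (Hom.id M) = F := by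
  refine Hom.ext rfl rfl ?_
  ext x y
  simp [Hom.comp, Hom.id, M.comp_eq]

instance : Category (Hom L M) where
  Hom F G := Hom₂ F G
  id F := Hom₂.id F
  comp θ η := θ.vcomp η
  id_comp θ := by
    apply Hom₂.ext; ext x
    simp [Hom₂.vcomp, Hom₂.id, M.comp_eq]
  comp_id θ := by
    apply Hom₂.ext; ext x
    simp [Hom₂.vcomp, Hom₂.id, M.comp_eq]
  assoc θ η ζ := by
    apply Hom₂.ext; ext x
    simp [Hom₂.vcomp, M.comp_assoc]

theorem Hom₂.app_comp {F G H : Hom L M} (θ : F ⟶ G) (η : G ⟶ H) (x : L.Obj) :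
    Hom₂.app (θ ≫ η) x = Hom₂.app θ x + Hom₂.app η x - M.idn (G.obj x) := by
  change M.comp (Hom₂.app θ x) (Hom₂.app η x) _ = _
  rw [M.comp_eq, Hom₂.tgt_app]

theorem Hom₂.app_eqToHom {F G : Hom L M} (h : F = G) (x : L.Obj) :
    Hom₂.app (eqToHom h) x = M.idn (F.obj x) := by
  subst h; rfl

theorem Hom₂.app_id (F : Hom L M) (x : L.Obj) : Hom₂.app (𝟙 F) x = M.idn (F.obj x) := rfl

theorem Hom₂.app_whiskerLeft (F : Hom L M) {G H : Hom M N} (η : G ⟶ H) (x : L.Obj) :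
    (Hom₂.whiskerLeft F η).app x = Hom₂.app η (F.obj x) := rfl

theorem Hom₂.app_whiskerRight {F G : Hom L M} (θ : F ⟶ G) (H : Hom M N) (x : L.Obj) :
    (Hom₂.whiskerRight θ H).app x = H.arr (Hom₂.app θ x) := rfl

theorem Hom.comp_obj (F : Hom L M) (G : Hom M N) (x : L.Obj) :
    (F.comp G).obj x = G.obj (F.obj x) := rfl

theorem Hom.comp_arr (F : Hom L M) (G : Hom M N) (f : L.Arr) :
    (F.comp G).arr f = G.arr (F.arr f) := rfl

theorem Hom.id_obj (x : L.Obj) : (Hom.id L).obj x = x := rfl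

theorem Hom.id_arr (f : L.Arr) : (Hom.id L).arr f = f := rfl

/-- The `2`-category of semi-strict Lie `2`-algebras. Composition of morphisms is strictly
associative and unital, and the associators and unitors are the identities. -/
instance : Bicategory (SemistrictLie2Algebra.{u, v} K) where
  Hom L M := Hom L M
  id L := Hom.id L
  comp F G := F.comp G
  whiskerLeft F _ _ η := Hom₂.whiskerLeft F η
  whiskerRight θ H := Hom₂.whiskerRight θ H
  associator F G H := eqToIso (Hom.comp_assoc F G H)
  leftUnitor F := eqToIso (Hom.id_comp F)
  rightUnitor F := eqToIso (Hom.comp_id F)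
  whiskerLeft_id := by
    intros; apply Hom₂.ext; ext x; rfl
  whiskerLeft_comp := by
    intros; apply Hom₂.ext; ext x; rfl
  id_whiskerLeft η := by
    apply Hom₂.ext; ext x
    simp [Hom₂.app_comp, Hom₂.app_eqToHom, Hom₂.app_whiskerLeft, Hom.id_obj, Hom.comp_obj]
  comp_whiskerLeft F G _ _ η := by
    apply Hom₂.ext; ext x
    simp [Hom₂.app_comp, Hom₂.app_eqToHom, Hom₂.app_whiskerLeft, Hom.comp_obj]
  id_whiskerRight F G := by
    apply Hom₂.ext; ext x
    simp [Hom₂.app_id, Hom₂.app_whiskerRight, Hom.comp_obj]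
  comp_whiskerRight θ η H := by
    apply Hom₂.ext; ext x
    simp [Hom₂.app_comp, Hom₂.app_whiskerRight, Hom.comp_obj]
  whiskerRight_id θ := by
    apply Hom₂.ext; ext x
    simp [Hom₂.app_comp, Hom₂.app_eqToHom, Hom₂.app_whiskerRight, Hom.id_arr, Hom.id_obj,
      Hom.comp_obj]
  whiskerRight_comp θ G H := by
    apply Hom₂.ext; ext x
    simp [Hom₂.app_comp, Hom₂.app_eqToHom, Hom₂.app_whiskerRight, Hom.comp_obj, Hom.comp_arr]
  whisker_assoc F _ _ η H := by
    apply Hom₂.ext; ext x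
    simp [Hom₂.app_comp, Hom₂.app_eqToHom, Hom₂.app_whiskerLeft, Hom₂.app_whiskerRight,
      Hom.comp_obj]
  whisker_exchange {_ _ P} F G H I θ η := by
    apply Hom₂.ext; ext x
    have h1 := Hom₂.natural η (Hom₂.app θ x)
    simp only [P.comp_eq] at h1
    simp only [Hom₂.app_comp, Hom₂.app_whiskerLeft, Hom₂.app_whiskerRight, Hom.comp_obj]
    simp at h1
    rw [h1]
  pentagon F G H I := by
    apply Hom₂.ext; ext x
    simp [Hom₂.app_comp, Hom₂.app_eqToHom, Hom₂.app_whiskerLeft, Hom₂.app_whiskerRight,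
      Hom.comp_obj]
  triangle F G := by
    apply Hom₂.ext; ext x
    simp [Hom₂.app_comp, Hom₂.app_eqToHom, Hom₂.app_whiskerLeft, Hom₂.app_whiskerRight,
      Hom.comp_obj, Hom.id_obj]

instance : Bicategory.Strict (SemistrictLie2Algebra.{u, v} K) where
  id_comp F := Hom.id_comp F
  comp_id F := Hom.comp_id F
  assoc F G H := Hom.comp_assoc F G H
  leftUnitor_eqToIso _ := rfl
  rightUnitor_eqToIso _ := rfl
  associator_eqToIso _ _ _ := rfl

end Bicategory

/-- A semi-strict Lie `2`-algebra is skeletal if the differential `d = t|_{ker s}` is zero. -/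
def IsSkeletal (L : SemistrictLie2Algebra.{u, v} K) : Prop := L.diff = 0

/-- `S` is a skeletal model of `L`: it is skeletal and comes with an equivalence `F : S → L` in
the `2`-category of semi-strict Lie `2`-algebras which exhibits its underlying complex as the
cohomology `ker d → coker d` (with zero differential) of the complex of `L`: `F` is on objects a
section of a quotient map with kernel `im d`, and it maps `ker s_S` bijectively onto `ker d`. -/
def IsSkeletalModel (S L : SemistrictLie2Algebra.{u, v} K) : Prop :=
  S.IsSkeletal ∧ ∃ e : Bicategory.Equivalence S L,
    (∃ q : L.Obj →ₗ[K] S.Obj, Function.Surjective q ∧ LinearMap.ker q = LinearMap.range L.diff ∧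
      ∀ x, q (Hom.obj e.hom x) = x) ∧
    Set.BijOn (Hom.arr e.hom) {f | S.src f = 0} {f | L.src f = 0 ∧ L.tgt f = 0}

/-- The operation of objects on `ker s` by `x · v = [1_x, v]`. If `L` is skeletal, `L.Obj` is a Lie
algebra and `ker s` is an `L.Obj`-module. -/
def kerAction (L : SemistrictLie2Algebra.{u, v} K) (x : L.Obj) (w : LinearMap.ker L.src) :
    LinearMap.ker L.src :=
  ⟨L.brArr (L.idn x) w, by simp⟩

/-- The arrow part of the Jacobiator. If `L` is skeletal, this is a `3`-cocycle of the Lie algebra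
`L.Obj` with values in `ker s`. -/
def l₃ (L : SemistrictLie2Algebra.{u, v} K) (x y z : L.Obj) : LinearMap.ker L.src :=
  L.arrowPart (L.jac x y z)

end SemistrictLie2Algebra

/-- A strict Lie `2`-algebra over `K`: a category object in the category of Lie algebras over `K`.
The fields `comp_add`, `comp_smul` and `comp_lie` say that the composition is a morphism of Lie
algebras on the pullback `Arr ×_Obj Arr`. -/
structure StrictLie2Algebra (K : Type u) [Field K] where
  Obj : Type v
  Arr : Type v
  [lieRingObj : LieRing Obj]
  [lieAlgebraObj : LieAlgebra K Obj]
  [lieRingArr : LieRing Arr]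
  [lieAlgebraArr : LieAlgebra K Arr]
  src : Arr →ₗ⁅K⁆ Obj
  tgt : Arr →ₗ⁅K⁆ Obj
  idn : Obj →ₗ⁅K⁆ Arr
  comp : (f g : Arr) → tgt f = src g → Arr
  src_idn : ∀ x, src (idn x) = x
  tgt_idn : ∀ x, tgt (idn x) = x
  src_comp : ∀ f g h, src (comp f g h) = src f
  tgt_comp : ∀ f g h, tgt (comp f g h) = tgt g
  comp_add : ∀ (f g f' g' : Arr) (h : tgt f = src g) (h' : tgt f' = src g'),
    comp (f + f') (g + g') (by rw [map_add, map_add, h, h']) = comp f g h + comp f' g' h'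
  comp_smul : ∀ (c : K) (f g : Arr) (h : tgt f = src g),
    comp (c • f) (c • g) (by rw [map_smul, map_smul, h]) = c • comp f g h
  comp_lie : ∀ (f g f' g' : Arr) (h : tgt f = src g) (h' : tgt f' = src g'),
    comp ⁅f, f'⁆ ⁅g, g'⁆ (by rw [LieHom.map_lie, LieHom.map_lie, h, h']) =
      ⁅comp f g h, comp f' g' h'⁆
  idn_comp : ∀ f, comp (idn (src f)) f (tgt_idn _) = f
  comp_idn : ∀ f, comp f (idn (tgt f)) (src_idn _).symm = f
  comp_assoc : ∀ (f g k : Arr) (h : tgt f = src g) (h' : tgt g = src k),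
    comp (comp f g h) k ((tgt_comp f g h).trans h') =
      comp f (comp g k h') (h.trans (src_comp g k h').symm)

attribute [instance] StrictLie2Algebra.lieRingObj StrictLie2Algebra.lieAlgebraObj
  StrictLie2Algebra.lieRingArr StrictLie2Algebra.lieAlgebraArr

namespace StrictLie2Algebra

variable {K : Type u} [Field K]

/-- The `2`-vector space underlying a strict Lie `2`-algebra. -/
def toTwoVectorSpace (M : StrictLie2Algebra.{u, v} K) : TwoVectorSpace.{u, v} K where
  Obj := M.Obj
  Arr := M.Arr
  src := M.src
  tgt := M.tgt
  idn := M.idn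
  comp := M.comp
  src_idn := M.src_idn
  tgt_idn := M.tgt_idn
  src_comp := M.src_comp
  tgt_comp := M.tgt_comp
  comp_add := M.comp_add
  comp_smul := M.comp_smul
  idn_comp := M.idn_comp
  comp_idn := M.comp_idn
  comp_assoc := M.comp_assoc

/-- The Lie bracket of a Lie algebra, as a bilinear map. -/
def lieBilin (A : Type v) [LieRing A] [LieAlgebra K A] : A →ₗ[K] A →ₗ[K] A :=
  LinearMap.mk₂ K (fun x y => ⁅x, y⁆) add_lie smul_lie lie_add (fun c x y => lie_smul c x y)

@[simp] theorem lieBilin_apply (A : Type v) [LieRing A] [LieAlgebra K A] (x y : A) :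
    lieBilin (K := K) A x y = ⁅x, y⁆ := rfl

/-- A strict Lie `2`-algebra as a `2`-vector space with bracket, given by the Lie brackets on
objects and on arrows, and with the identity arrows of the objects `[[x,y],z]` as `jac`. -/
def toPreLie2Algebra (M : StrictLie2Algebra.{u, v} K) : PreLie2Algebra.{u, v} K where
  toTwoVectorSpace := M.toTwoVectorSpace
  brObj := (id (lieBilin M.Obj) : M.Obj →ₗ[K] M.Obj →ₗ[K] M.Obj)
  brArr := (id (lieBilin M.Arr) : M.Arr →ₗ[K] M.Arr →ₗ[K] M.Arr)
  src_brArr f g := M.src.map_lie f g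
  tgt_brArr f g := M.tgt.map_lie f g
  brArr_idn x y := (M.idn.map_lie x y).symm
  brArr_comp f f' g g' h h' := (M.comp_lie f f' g g' h h').symm
  brObj_skew x y := (lie_skew (L := M.Obj) x y).symm
  brArr_skew f g := (lie_skew (L := M.Arr) f g).symm
  jac := (id ((lieBilin M.Obj).compr₂ ((lieBilin M.Obj).compr₂ (M.idn : M.Obj →ₗ[K] M.Arr))) :
    M.Obj →ₗ[K] M.Obj →ₗ[K] M.Obj →ₗ[K] M.Arr)
  src_jac x y z := M.src_idn _
  tgt_jac x y z := by
    have h : ∀ x y z : M.Obj, ⁅⁅x, y⁆, z⁆ = ⁅x, ⁅y, z⁆⁆ + ⁅⁅x, z⁆, y⁆ := fun x y z => by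
      rw [lie_lie x y z, ← lie_skew ⁅x, z⁆ y]; abel
    exact (M.tgt_idn _).trans (h x y z)

/-- A strict Lie `2`-algebra as a semi-strict one: the functorial bracket is given by the Lie
brackets on objects and on arrows, and the Jacobiator is the identity. -/
def toSemistrict (M : StrictLie2Algebra.{u, v} K) : SemistrictLie2Algebra.{u, v} K where
  toPreLie2Algebra := M.toPreLie2Algebra
  isSemistrict := by
    refine PreLie2Algebra.isSemistrict_of_jac_eq_idn _ (fun x y z => rfl) ?_
    have hl : ∀ f g k : M.Arr, ⁅⁅f, g⁆, k⁆ = ⁅f, ⁅g, k⁆⁆ + ⁅⁅f, k⁆, g⁆ := fun x y z => by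
      rw [lie_lie x y z, ← lie_skew ⁅x, z⁆ y]; abel
    exact hl

/-- The arrow part of the functorial bracket of `f : x → y` and `g : a → b` in a strict Lie
`2`-algebra is `[1_x, g⃗] + [f⃗, 1_b]`. -/
theorem arrowPart_lie (M : StrictLie2Algebra.{u, v} K) (f g : M.Arr) :
    ⁅f, g⁆ - M.idn ⁅M.src f, M.src g⁆ =
      ⁅M.idn (M.src f), g - M.idn (M.src g)⁆ + ⁅f - M.idn (M.src f), M.idn (M.tgt g)⁆ := by
  have hc : ∀ (f g : M.Arr) (h : M.tgt f = M.src g), M.comp f g h = f + g - M.idn (M.tgt f) :=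
    M.toTwoVectorSpace.comp_eq
  have h := M.comp_lie (g - M.idn (M.tgt g)) 0 0 (f - M.idn (M.src f)) (by simp [M.tgt_idn])
    (by simp [M.src_idn])
  simp [hc, M.tgt_idn] at h
  simp only [lie_sub, sub_lie, LieHom.map_lie]
  rw [← lie_skew (g) f, ← lie_skew g (M.idn (M.src f)), ← lie_skew (M.idn (M.tgt g)) f,
    ← lie_skew (M.idn (M.tgt g)) (M.idn (M.src f))] at h
  rw [← sub_eq_zero, ← neg_eq_zero]
  rw [eq_comm] at h
  rw [← h]
  abel

end StrictLie2Algebra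

/-- A crossed module `μ : H → G` of Lie algebras over `K`. -/
structure LieCrossedModule (K : Type u) [Field K] where
  H : Type v
  G : Type v
  [lieRingH : LieRing H]
  [lieAlgebraH : LieAlgebra K H]
  [lieRingG : LieRing G]
  [lieAlgebraG : LieAlgebra K G]
  μ : H →ₗ⁅K⁆ G
  act : G →ₗ⁅K⁆ LieDerivation K H H
  μ_act : ∀ (g : G) (h : H), μ (act g h) = ⁅g, μ h⁆
  act_μ : ∀ h h' : H, act (μ h) h' = ⁅h, h'⁆

attribute [instance] LieCrossedModule.lieRingH LieCrossedModule.lieAlgebraH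
  LieCrossedModule.lieRingG LieCrossedModule.lieAlgebraG

/-- The Chevalley-Eilenberg differential of a `2`-cochain `φ` on `A` with values in `M`, as a
formula in a bracket on `A` and an operation of `A` on `M`. -/
def ceDifferential {A M : Type*} [AddCommGroup M] (br : A → A → A) (act : A → M → M)
    (φ : A → A → M) (x y z : A) : M :=
  act x (φ y z) - act y (φ x z) + act z (φ x y)
    - φ (br x y) z + φ (br x z) y - φ (br y z) x

namespace LieCrossedModule

variable {K : Type u} [Field K]

/-- The strict Lie `2`-algebra of a crossed module: its Lie algebra of objects is `G`, its Lie
algebra of arrows is the semidirect sum of `H` and `G`, with `s (h, g) = g`, `t (h, g) = μ h + g`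
and `i g = (0, g)`. -/
def toStrict (X : LieCrossedModule.{u, v} K) : StrictLie2Algebra.{u, v} K where
  Obj := X.G
  Arr := LieAlgebra.SemiDirectSum X.H X.G X.act
  src := LieAlgebra.SemiDirectSum.projr X.act
  tgt :=
    { toFun := fun a => X.μ a.left + a.right
      map_add' := fun a b => by simp; abel
      map_smul' := fun c a => by simp
      map_lie' := fun {a b} => by
        simp [X.μ_act]
        rw [← lie_skew (X.μ a.left) b.right]
        abel }
  idn := LieAlgebra.SemiDirectSum.inr X.act
  comp := fun a b _ => ⟨a.left + b.left, a.right⟩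
  src_idn x := rfl
  tgt_idn x := by simp
  src_comp a b h := rfl
  tgt_comp a b h := by
    simp at h ⊢
    rw [← h]; abel
  comp_add a b a' b' h h' := by simp; abel
  comp_smul c a b h := by simp
  comp_lie a b a' b' h h' := by
    simp at h h' ⊢
    rw [← h, ← h']
    simp [X.act_μ]
    rw [← lie_skew a'.left b.left]
    abel
  idn_comp a := by simp
  comp_idn a := by simp
  comp_assoc a b c h h' := by simp [add_assoc]

/-- For a skeletal `S`, with associated triple `(S.Obj, ker s, [l₃])`: the crossed module
`μ : H → G` realizes this triple. That is, `ker s ≅ ker μ` through `ι` and `coker μ ≅ S.Obj` through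
`p`, compatibly with the action and with the brackets, and under these identifications the class
in `H³(coker μ, ker μ)` of `X` is the class of `l₃`. The class of `X` is that of the cocycle
`d_CE φ`, where `σ` is a linear section of `p` and `φ` is a lift along `μ` of the defect
`σ [x, y] - [σ x, σ y]` of `σ` to be a morphism of Lie algebras; it differs from `l₃` by the
coboundary of a `2`-cochain `θ` with values in `ker s`. -/
def Realizes (X : LieCrossedModule.{u, v} K) (S : SemistrictLie2Algebra.{u, v} K) : Prop :=
  ∃ (ι : LinearMap.ker S.src →ₗ[K] X.H) (p : X.G →ₗ[K] S.Obj),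
    Function.Injective ι ∧ (∀ h, (∃ w, ι w = h) ↔ X.μ h = 0) ∧
    Function.Surjective p ∧ (∀ g, p g = 0 ↔ ∃ h, X.μ h = g) ∧
    (∀ g g', p ⁅g, g'⁆ = S.brObj (p g) (p g')) ∧
    (∀ g w, X.act g (ι w) = ι (S.kerAction (p g) w)) ∧
    ∃ (σ : S.Obj →ₗ[K] X.G) (φ : S.Obj →ₗ[K] S.Obj →ₗ[K] X.H)
      (θ : S.Obj →ₗ[K] S.Obj →ₗ[K] LinearMap.ker S.src),
      (∀ x, p (σ x) = x) ∧
      (∀ x y, φ x y = - φ y x) ∧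
      (∀ x y, X.μ (φ x y) = σ (S.brObj x y) - ⁅σ x, σ y⁆) ∧
      (∀ x y, θ x y = - θ y x) ∧
      ∀ x y z, ι (S.l₃ x y z) =
        ceDifferential (fun a b => S.brObj a b) (fun a h => X.act (σ a) h) (fun a b => φ a b) x y z
          + ι (ceDifferential (fun a b => S.brObj a b) S.kerAction (fun a b => θ a b) x y z)

end LieCrossedModule

/-! A semi-strict Lie `2`-algebra is a two-term `L∞`-algebra on `d : ker s → L₀`. Composing arrows
adds their arrow parts, so functoriality, naturality and the Jacobiator identity turn into linear
equations between `d`, the bracket of objects, their action on `ker s` and the arrow part of the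
Jacobiator (`kerAct_diff`, `jacPart_diff`, `jacPart_cocycle`). Morphisms and `2`-morphisms are
translated likewise (`Hom.ofParts`, `Hom₂.ofPart`), and every `2`-morphism is invertible.

Over a field the complex splits as its cohomology plus an acyclic part. Homotopy transfer along a
splitting gives a Lie algebra on `coker d`, a module `ker d` and a `3`-cocycle, that is, a skeletal
Lie `2`-algebra with a morphism to `L`. A morphism out of a skeletal object that is an isomorphism
on cohomology is an equivalence (`Hom.exists_equivalence_of_isSkeletal`). The same criterion applies
to a crossed module realizing the triple of `S`: a section `σ`, the inclusion `ι` and the bilinear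
map `φ + ι θ` form a morphism from `S` to its strict Lie `2`-algebra.

It remains to realize every cocycle `c` on `g` with values in `V`. Suppose `p : G → g` is a
surjection of Lie algebras with `p^* c = -dω`. On `ker p` the form `ω` is a cocycle with trivial
coefficients; the central extension of `ker p` by `V` that it defines, with `G` acting through `ω`,
is a crossed module over `G` with class `c`. Such a cover is built from polynomial paths in `g`
starting at `0`, evaluated at `1`. By the fundamental theorem of calculus, `c(ξ(1), η(1), ζ(1))` is
the integral over `[0,1]` of `c(ξ', η, ζ) + c(ξ, η', ζ) + c(ξ, η, ζ')`. This is almost a coboundary: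
it becomes one after extending the path algebra by paths in `Hom(g, V)` with cocycle `-c(ξ, η, ·)`,
where `ω` pairs a path in `Hom(g, V)` with the derivative of a path in `g` and integrates.
Characteristic `0` provides the antiderivatives, and turns skew-symmetric brackets into alternating
ones. -/

/-- A Lie algebra `g` (given by its bracket), a `g`-module `V` (given by its action) and a
Chevalley-Eilenberg `3`-cocycle on `g` with values in `V`. -/
structure LieThreeCocycle (K : Type*) [Field K] (g V : Type*) [AddCommGroup g] [Module K g]
    [AddCommGroup V] [Module K V] where
  br : g →ₗ[K] g →ₗ[K] g
  act : g →ₗ[K] V →ₗ[K] V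
  c : g →ₗ[K] g →ₗ[K] g →ₗ[K] V
  br_skew : ∀ x y, br x y = - br y x
  jacobi : ∀ x y z, br (br x y) z = br x (br y z) + br (br x z) y
  act_br : ∀ x y w, act (br x y) w = act x (act y w) - act y (act x w)
  c_left : ∀ x y z, c x y z = - c y x z
  c_right : ∀ x y z, c x y z = - c x z y
  cocycle : ∀ w x y z,
    act w (c x y z) - act x (c w y z) + act y (c w x z) - act z (c w x y)
      - c (br w x) y z + c (br w y) x z - c (br w z) x y - c (br x y) w z + c (br x z) w y
      - c (br y z) w x = 0

/-- A Lie algebra `G` over `g`, with a linear section, on which the pullback of the cocycle `-c` is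
the differential of the `2`-cochain `ω`. -/
structure LieThreeCocycle.ExactCover {K : Type*} [Field K] {g V : Type*} [AddCommGroup g]
    [Module K g] [AddCommGroup V] [Module K V] (T : LieThreeCocycle K g V) where
  G : Type*
  [lieRing : LieRing G]
  [lieAlgebra : LieAlgebra K G]
  p : G →ₗ[K] g
  p_lie : ∀ a b, p ⁅a, b⁆ = T.br (p a) (p b)
  σ : g →ₗ[K] G
  p_σ : ∀ x, p (σ x) = x
  ω : G →ₗ[K] G →ₗ[K] V
  ω_skew : ∀ a b, ω a b = - ω b a
  d_ω : ∀ a b c, T.act (p a) (ω b c) - T.act (p b) (ω a c) + T.act (p c) (ω a b)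
    - ω ⁅a, b⁆ c + ω ⁅a, c⁆ b - ω ⁅b, c⁆ a = - T.c (p a) (p b) (p c)

attribute [instance] LieThreeCocycle.ExactCover.lieRing LieThreeCocycle.ExactCover.lieAlgebra

theorem eq_zero_of_eq_neg_self (K : Type*) [Field K] [CharZero K] {V : Type*} [AddCommGroup V]
    [Module K V] {x : V} (h : x = -x) : x = 0 := by
  have h2 : (2 : K) • x = 0 := by rw [two_smul]; nth_rw 2 [h]; exact add_neg_cancel x
  exact (smul_eq_zero.1 h2).resolve_left two_ne_zero

/-! ### The crossed module of a cover on which the cocycle is exact -/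

namespace LieThreeCocycle.ExactCover

section

variable {K : Type*} [Field K] {g V : Type*} [AddCommGroup g] [Module K g] [AddCommGroup V]
  [Module K V] {T : LieThreeCocycle K g V} (E : T.ExactCover)

/-- The central extension of `ker p` by `V` with cocycle `ω`. -/
def H : Type _ := V × LinearMap.ker E.p

instance : AddCommGroup E.H := inferInstanceAs (AddCommGroup (V × LinearMap.ker E.p))

instance : Module K E.H := inferInstanceAs (Module K (V × LinearMap.ker E.p))

/-- The component in `V` of an element of `E.H`. -/
def fstH : E.H →ₗ[K] V := LinearMap.fst K V (LinearMap.ker E.p)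

/-- The projection of `E.H` to `E.G`. -/
def sndH : E.H →ₗ[K] E.G := (LinearMap.ker E.p).subtype ∘ₗ LinearMap.snd K V (LinearMap.ker E.p)

/-- The element `(w, r)` of `E.H`. -/
def mkH (w : V) (r : E.G) (hr : E.p r = 0) : E.H := (w, ⟨r, hr⟩)

/-- The inclusion of `V` into `E.H`. -/
def inlH : V →ₗ[K] E.H := LinearMap.inl K V (LinearMap.ker E.p)

@[simp] theorem fstH_mkH (w : V) (r : E.G) (hr : E.p r = 0) : E.fstH (E.mkH w r hr) = w := rfl

@[simp] theorem sndH_mkH (w : V) (r : E.G) (hr : E.p r = 0) : E.sndH (E.mkH w r hr) = r := rfl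

@[simp] theorem p_sndH (h : E.H) : E.p (E.sndH h) = 0 := h.2.2

theorem extH {h h' : E.H} (h1 : E.fstH h = E.fstH h') (h2 : E.sndH h = E.sndH h') : h = h' :=
  Prod.ext h1 (Subtype.ext h2)

/-- The lift of the defect of `E.σ` to be a morphism of Lie algebras. -/
def defect : g →ₗ[K] g →ₗ[K] E.H :=
  LinearMap.mk₂ K
    (fun x y => E.mkH (- E.ω (E.σ x) (E.σ y)) (E.σ (T.br x y) - ⁅E.σ x, E.σ y⁆)
      (by simp [E.p_lie, E.p_σ]))
    (fun x y z => E.extH (by simp only [map_add, fstH_mkH, LinearMap.add_apply]; abel)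
      (by simp only [map_add, sndH_mkH, LinearMap.add_apply, add_lie]; abel))
    (fun x y z => E.extH (by simp only [map_smul, fstH_mkH, LinearMap.smul_apply]; module)
      (by simp only [map_smul, sndH_mkH, LinearMap.smul_apply, smul_lie]; module))
    (fun x y z => E.extH (by simp only [map_add, fstH_mkH]; abel)
      (by simp only [map_add, sndH_mkH, lie_add]; abel))
    (fun x y z => E.extH (by simp only [map_smul, fstH_mkH]; module)
      (by simp only [map_smul, sndH_mkH, lie_smul]; module))

@[simp] theorem fstH_defect (x y : g) : E.fstH (E.defect x y) = - E.ω (E.σ x) (E.σ y) := rfl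

@[simp] theorem sndH_defect (x y : g) :
    E.sndH (E.defect x y) = E.σ (T.br x y) - ⁅E.σ x, E.σ y⁆ := rfl

theorem defect_skew (x y : g) : E.defect x y = - E.defect y x := by
  refine E.extH ?_ ?_
  · rw [map_neg, fstH_defect, fstH_defect, E.ω_skew]
  · rw [map_neg, sndH_defect, sndH_defect, T.br_skew, ← lie_skew, map_neg]
    abel

/-- The operation of `E.G` on `E.H`. -/
def actH (a : E.G) (h : E.H) : E.H :=
  E.mkH (T.act (E.p a) (E.fstH h) + E.ω a (E.sndH h)) ⁅a, E.sndH h⁆ (by simp [E.p_lie])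

theorem fstH_actH (a : E.G) (h : E.H) :
    E.fstH (E.actH a h) = T.act (E.p a) (E.fstH h) + E.ω a (E.sndH h) := rfl

theorem sndH_actH (a : E.G) (h : E.H) : E.sndH (E.actH a h) = ⁅a, E.sndH h⁆ := rfl

/-- In the `V` component, the terms pairing `E.σ` of an element with `E.σ` of a bracket cancel
between the action and the defect; what remains is `-dω` at the lifted elements, which is `c`. The
component in `ker p` vanishes by the Jacobi identities of `g` and of `E.G`. -/
theorem ceDifferential_defect (x y z : g) :
    ceDifferential (fun a b => T.br a b) (fun a h => E.actH (E.σ a) h) (fun a b => E.defect a b)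
      x y z = E.inlH (T.c x y z) := by
  change _ = E.mkH (T.c x y z) 0 (map_zero _)
  refine E.extH ?_ ?_
  · have h := E.d_ω (E.σ x) (E.σ y) (E.σ z)
    simp only [ceDifferential, map_add, map_sub, fstH_actH, fstH_mkH, fstH_defect, sndH_defect,
      E.p_σ, map_neg] at h ⊢
    rw [E.ω_skew (E.σ x), E.ω_skew (E.σ y) (E.σ (T.br x z)), E.ω_skew (E.σ z) (E.σ (T.br x y)),
      E.ω_skew (E.σ x), E.ω_skew (E.σ y) ⁅_, _⁆, E.ω_skew (E.σ z) ⁅_, _⁆]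
    linear_combination (norm := module) -h
  · have h := congrArg E.σ (T.jacobi x y z)
    have h' := leibniz_lie (E.σ x) (E.σ y) (E.σ z)
    simp only [ceDifferential, map_add, map_sub, sndH_actH, sndH_mkH, sndH_defect, lie_sub,
      map_add] at h ⊢
    rw [T.br_skew (T.br y z) x, map_neg]
    rw [← lie_skew (E.σ (T.br x y)), ← lie_skew (E.σ (T.br x z)), ← lie_skew (E.σ (T.br y z))]
    rw [← lie_skew ⁅E.σ x, E.σ y⁆ (E.σ z)] at h'
    linear_combination (norm := module) -h - h'

/-- In `d_ω` with third argument in `ker p`, both the cocycle and the action of that argument drop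
out. This single identity gives the Jacobi identity of `E.H`, the derivation property of the action
and its compatibility with brackets. -/
theorem ω_lie (a b : E.G) (h : E.H) :
    E.ω ⁅a, b⁆ (E.sndH h) = T.act (E.p a) (E.ω b (E.sndH h)) + E.ω a ⁅b, E.sndH h⁆
      - (T.act (E.p b) (E.ω a (E.sndH h)) + E.ω b ⁅a, E.sndH h⁆) := by
  have h1 := E.d_ω a b (E.sndH h)
  rw [E.ω_skew ⁅a, E.sndH h⁆, E.ω_skew ⁅b, E.sndH h⁆] at h1
  simp at h1
  linear_combination (norm := module) -h1

variable [CharZero K]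

theorem ω_self (a : E.G) : E.ω a a = 0 :=
  eq_zero_of_eq_neg_self K (E.ω_skew a a)

/-- The bracket is defined as the action through the projection to `E.G`, so the Peiffer identity of
the crossed module holds by definition. -/
instance : LieRing E.H where
  bracket h h' := E.actH (E.sndH h) h'
  add_lie a b c := E.extH (by simp [fstH_actH]) (by simp [sndH_actH])
  lie_add a b c := E.extH (by simp [fstH_actH]) (by simp [sndH_actH])
  lie_self a := E.extH (by simp [fstH_actH, ω_self]) (by simp [sndH_actH])
  leibniz_lie a b c := E.extH
    (by
      simp only [fstH_actH, sndH_actH, map_add, p_sndH, E.p_lie, map_zero,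
        LinearMap.zero_apply, zero_add]
      rw [ω_lie]
      simp)
    (by simp [sndH_actH])

theorem lieH_eq (h h' : E.H) : ⁅h, h'⁆ = E.actH (E.sndH h) h' := rfl

instance : LieAlgebra K E.H where
  lie_smul t a b := E.extH (by simp [lieH_eq, fstH_actH]) (by simp [lieH_eq, sndH_actH])

/-- The operation of `E.G` on `E.H` by derivations. -/
def derivH (a : E.G) : LieDerivation K E.H E.H where
  toFun := E.actH a
  map_add' _ _ := E.extH (by simp [fstH_actH]; abel) (by simp [sndH_actH])
  map_smul' _ _ := E.extH (by simp [fstH_actH]) (by simp [sndH_actH])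
  leibniz' h h' := by
    refine E.extH ?_ ?_
    · have h1 := E.ω_lie a (E.sndH h) h'
      simp [lieH_eq, fstH_actH, sndH_actH] at h1 ⊢
      rw [E.ω_skew (E.sndH h') ⁅a, E.sndH h⁆]
      linear_combination (norm := module) -h1
    · simp only [lieH_eq, sndH_actH, LinearMap.coe_mk, AddHom.coe_mk, map_sub]
      rw [leibniz_lie, ← lie_skew (E.sndH h') ⁅a, E.sndH h⁆]
      abel

@[simp] theorem derivH_apply (a : E.G) (h : E.H) : E.derivH a h = E.actH a h := rfl

end

/-- The crossed module `V × ker p → G`. -/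
def crossedModule {K : Type u} [Field K] [CharZero K] {g V : Type v} [AddCommGroup g] [Module K g]
    [AddCommGroup V] [Module K V] {T : LieThreeCocycle K g V} (E : ExactCover.{_, _, _, v} T) :
    LieCrossedModule.{u, v} K where
  H := E.H
  G := E.G
  μ := { E.sndH with map_lie' := fun {_ _} => rfl }
  act :=
    { toFun := E.derivH
      map_add' := fun a b => by
        ext h
        exact E.extH (by simp [fstH_actH]; abel) (by simp [sndH_actH])
      map_smul' := fun t a => by
        ext h
        exact E.extH (by simp [fstH_actH]) (by simp [sndH_actH])
      map_lie' := fun {a b} => by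
        ext h
        refine E.extH ?_ ?_
        · simp [fstH_actH, sndH_actH, E.p_lie, E.ω_lie, T.act_br]
          abel
        · simp [sndH_actH] }
  μ_act a h := rfl
  act_μ h h' := rfl

end LieThreeCocycle.ExactCover

/-! ### The equations of a two-term `L∞`-algebra -/

namespace SemistrictLie2Algebra

variable {K : Type u} [Field K] (L : SemistrictLie2Algebra.{u, v} K)

theorem eq_arrowPart_add (f : L.Arr) : f = (L.arrowPart f : L.Arr) + L.idn (L.src f) := by simp

@[simp] theorem src_ker (a : LinearMap.ker L.src) : L.src (a : L.Arr) = 0 := a.2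

@[simp] theorem tgt_ker (a : LinearMap.ker L.src) : L.tgt (a : L.Arr) = L.diff a := rfl

@[simp] theorem arrowPart_idn (x : L.Obj) : L.arrowPart (L.idn x) = 0 := by
  ext; simp

@[simp] theorem arrowPart_ker (a : LinearMap.ker L.src) : L.arrowPart (a : L.Arr) = a := by
  ext; simp

/-- The bilinear operation of objects on `ker s`. -/
def kerAct : L.Obj →ₗ[K] LinearMap.ker L.src →ₗ[K] LinearMap.ker L.src :=
  LinearMap.mk₂ K L.kerAction (fun x y w => by ext; simp [kerAction])
    (fun c x w => by ext; simp [kerAction]) (fun x w w' => by ext; simp [kerAction])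
    (fun c x w => by ext; simp [kerAction])

theorem kerAct_apply (x : L.Obj) (a : LinearMap.ker L.src) : L.kerAct x a = L.kerAction x a := rfl

@[simp] theorem coe_kerAct (x : L.Obj) (a : LinearMap.ker L.src) :
    (L.kerAct x a : L.Arr) = L.brArr (L.idn x) a := rfl

theorem brArr_idn_left (x : L.Obj) (a : LinearMap.ker L.src) :
    L.brArr (L.idn x) a = L.kerAct x a := rfl

theorem brArr_idn_right (x : L.Obj) (a : LinearMap.ker L.src) :
    L.brArr a (L.idn x) = - (L.kerAct x a : L.Arr) := by
  rw [L.brArr_skew, coe_kerAct]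

/-- Interchange law: `a` is `a` followed by an identity, and `b` is `0` followed by `b`, so `[a, b]`
is `[a, 0] = 0` followed by `[1_{da}, b]`. -/
theorem brArr_ker (a b : LinearMap.ker L.src) :
    L.brArr a b = (L.kerAct (L.diff a) b : L.Arr) := by
  have h := L.brArr_comp a (L.idn (L.tgt a)) 0 b (L.src_idn _).symm (by simp)
  rw [L.comp_eq, L.comp_eq, L.comp_eq] at h
  simpa using h

theorem brArr_ker' (a b : LinearMap.ker L.src) :
    L.brArr a b = - (L.kerAct (L.diff b) a : L.Arr) := by
  rw [L.brArr_skew, brArr_ker]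

theorem kerAct_diff (a b : LinearMap.ker L.src) :
    L.kerAct (L.diff a) b = - L.kerAct (L.diff b) a :=
  Subtype.ext ((L.brArr_ker a b).symm.trans (L.brArr_ker' a b))

theorem diff_kerAct (x : L.Obj) (a : LinearMap.ker L.src) :
    L.diff (L.kerAct x a) = L.brObj x (L.diff a) := by
  change L.tgt _ = _
  simp

/-- The trilinear arrow part of the Jacobiator. -/
def jacPart : L.Obj →ₗ[K] L.Obj →ₗ[K] L.Obj →ₗ[K] LinearMap.ker L.src where
  toFun x := (L.jac x).compr₂ L.arrowPart
  map_add' x y := by ext; simp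
  map_smul' c x := by ext; simp

theorem jacPart_apply (x y z : L.Obj) : L.jacPart x y z = L.l₃ x y z := rfl

theorem jac_eq (x y z : L.Obj) :
    L.jac x y z = (L.jacPart x y z : L.Arr) + L.idn (L.brObj (L.brObj x y) z) := by
  rw [jacPart_apply, l₃]; simp

theorem jacPart_left (x y z : L.Obj) : L.jacPart x y z = - L.jacPart y x z :=
  L.isSemistrict.jac_antisymm_left x y z

theorem jacPart_right (x y z : L.Obj) : L.jacPart x y z = - L.jacPart x z y :=
  L.isSemistrict.jac_antisymm_right x y z

theorem diff_jacPart (x y z : L.Obj) :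
    L.diff (L.jacPart x y z) =
      L.brObj x (L.brObj y z) + L.brObj (L.brObj x z) y - L.brObj (L.brObj x y) z := by
  have h := congrArg L.tgt (L.jac_eq x y z)
  simp at h
  rw [h]; abel

/-- Naturality of the Jacobiator along `1_x`, `1_y` and the arrow `a : 0 → da`: the action on `ker
s` is a representation up to the Jacobiator. -/
theorem jacPart_diff (x y : L.Obj) (a : LinearMap.ker L.src) :
    L.jacPart x y (L.diff a) =
      L.kerAct x (L.kerAct y a) - L.kerAct y (L.kerAct x a) - L.kerAct (L.brObj x y) a := by
  have h := L.isSemistrict.jac_natural (L.idn x) (L.idn y) a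
  simp only [L.comp_eq, L.jac_eq] at h
  simp only [L.brArr_idn, brArr_idn_left, brArr_idn_right] at h
  simp only [L.src_idn, L.tgt_idn, src_ker, tgt_ker, map_zero, map_add,
    ZeroMemClass.coe_zero] at h
  simp [-coe_kerAct, diff_kerAct] at h
  ext
  simp [-coe_kerAct]
  linear_combination (norm := module) h

/-- Arrow parts add under composition and vanish on identities, so both sides of the Jacobiator
identity become sums. This does not require `d = 0`. -/
theorem jacPart_cocycle (w x y z : L.Obj) :
    L.kerAct w (L.jacPart x y z) - L.kerAct x (L.jacPart w y z) + L.kerAct y (L.jacPart w x z)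
      - L.kerAct z (L.jacPart w x y)
      - L.jacPart (L.brObj w x) y z + L.jacPart (L.brObj w y) x z - L.jacPart (L.brObj w z) x y
      - L.jacPart (L.brObj x y) w z + L.jacPart (L.brObj x z) w y - L.jacPart (L.brObj y z) w x
      = 0 := by
  have h := congrArg L.arrowPart (L.isSemistrict.jacobiator_identity w x y z)
  simp only [L.comp_eq, L.jac_eq] at h
  simp only [map_add, map_sub, LinearMap.add_apply, brArr_idn_left, brArr_idn_right, map_neg,
    arrowPart_ker, arrowPart_idn, L.brArr_idn] at h
  rw [L.jacPart_right w (L.brObj x z) y, L.jacPart_left w y (L.brObj x z),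
    L.jacPart_right y w (L.brObj x z), L.jacPart_left y (L.brObj x z) w,
    L.jacPart_right w x (L.brObj y z), L.jacPart_left w (L.brObj y z) x,
    L.jacPart_left w (L.brObj x y) z] at h
  rw [L.jacPart_right (L.brObj x z) w y]
  linear_combination (norm := module) -h

end SemistrictLie2Algebra

/-! ### Morphisms and `2`-morphisms in terms of arrow parts -/

namespace SemistrictLie2Algebra

variable {K : Type u} [Field K] {L M : SemistrictLie2Algebra.{u, v} K}

/-- Splitting both arrows into arrow part and identity gives four brackets. The bracket of the two
arrow parts is the action of `t(f) - s(f)`, which changes the acting object from the source to the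
target of `f`. -/
theorem brArr_eq (f g : M.Arr) :
    M.brArr f g = ((M.kerAct (M.tgt f) (M.arrowPart g) - M.kerAct (M.src g) (M.arrowPart f) :
      LinearMap.ker M.src) : M.Arr) + M.idn (M.brObj (M.src f) (M.src g)) := by
  have h1 := M.brArr_ker (M.arrowPart f) (M.arrowPart g)
  have h2 : M.diff (M.arrowPart f) = M.tgt f - M.src f := by
    change M.tgt _ = _
    simp
  conv_lhs => rw [M.eq_arrowPart_add f, M.eq_arrowPart_add g]
  simp only [map_add, LinearMap.add_apply]
  rw [h1, h2, brArr_idn_left, brArr_idn_right, M.brArr_idn]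
  simp only [map_sub, LinearMap.sub_apply, AddSubgroupClass.coe_sub]
  abel

theorem diff_arrowPart (f : M.Arr) : M.diff (M.arrowPart f) = M.tgt f - M.src f := by
  change M.tgt _ = _
  simp

theorem tgt_eq (f : M.Arr) : M.tgt f = M.src f + M.diff (M.arrowPart f) := by
  rw [diff_arrowPart]; abel

theorem arrowPart_brArr (f g : M.Arr) : M.arrowPart (M.brArr f g) =
    M.kerAct (M.tgt f) (M.arrowPart g) - M.kerAct (M.src g) (M.arrowPart f) := by
  rw [brArr_eq, map_add, arrowPart_ker, arrowPart_idn, add_zero]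

theorem arrowPart_comp (f g : M.Arr) (h : M.tgt f = M.src g) :
    M.arrowPart (M.comp f g h) = M.arrowPart f + M.arrowPart g := by
  rw [M.comp_eq]; simp

/-- Arrows with the same source and the same arrow part are equal. -/
theorem arr_ext {f g : M.Arr} (h : M.src f = M.src g) (h' : M.arrowPart f = M.arrowPart g) :
    f = g := by
  rw [M.eq_arrowPart_add f, M.eq_arrowPart_add g, h, h']

/-- A morphism from its components on objects, on `ker s`, and the arrow parts of `map₂`. -/
def Hom.ofParts (F₀ : L.Obj →ₗ[K] M.Obj) (F₁ : LinearMap.ker L.src →ₗ[K] LinearMap.ker M.src)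
    (F₂ : L.Obj →ₗ[K] L.Obj →ₗ[K] LinearMap.ker M.src)
    (diff_F₁ : ∀ a, M.diff (F₁ a) = F₀ (L.diff a))
    (diff_F₂ : ∀ x y, M.diff (F₂ x y) = F₀ (L.brObj x y) - M.brObj (F₀ x) (F₀ y))
    (F₂_skew : ∀ x y, F₂ x y = - F₂ y x)
    (F₁_kerAct : ∀ x a, F₁ (L.kerAct x a) = M.kerAct (F₀ x) (F₁ a) + F₂ x (L.diff a))
    (F₁_jacPart : ∀ x y z, F₁ (L.jacPart x y z) = M.jacPart (F₀ x) (F₀ y) (F₀ z)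
      + M.kerAct (F₀ x) (F₂ y z) - M.kerAct (F₀ y) (F₂ x z) + M.kerAct (F₀ z) (F₂ x y)
      + F₂ x (L.brObj y z) + F₂ (L.brObj x z) y - F₂ (L.brObj x y) z) : Hom L M where
  obj := F₀
  arr := (LinearMap.ker M.src).subtype ∘ₗ F₁ ∘ₗ L.arrowPart + M.idn ∘ₗ F₀ ∘ₗ L.src
  src_arr f := by simp [-TwoVectorSpace.coe_arrowPart]
  tgt_arr f := by simp [-TwoVectorSpace.coe_arrowPart, diff_F₁, diff_arrowPart]
  arr_idn x := by simp [-TwoVectorSpace.coe_arrowPart]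
  arr_comp f g h := by
    refine arr_ext (by simp) ?_
    simp [-TwoVectorSpace.coe_arrowPart, arrowPart_comp]
  map₂ := F₂.compr₂ (LinearMap.ker M.src).subtype + (M.brObj.compl₁₂ F₀ F₀).compr₂ M.idn
  src_map₂ x y := by simp
  tgt_map₂ x y := by simp [diff_F₂]
  map₂_natural f g := by
    refine arr_ext (by simp) ?_
    simp only [arrowPart_comp, arrowPart_brArr]
    simp [-TwoVectorSpace.coe_arrowPart, arrowPart_brArr, diff_F₁, F₁_kerAct, tgt_eq]
    rw [F₂_skew (L.diff _) (L.src g)]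
    abel
  map₂_skew x y := by
    simp
    rw [F₂_skew, M.brObj_skew]
    simp
    abel
  map₂_jac x y z := by
    refine arr_ext (by simp) ?_
    simp only [arrowPart_comp, arrowPart_brArr, map_add]
    simp [-TwoVectorSpace.coe_arrowPart, arrowPart_brArr, M.jac_eq, L.jac_eq, F₁_jacPart]
    abel

/-- The component of a morphism on `ker s`. -/
def Hom.kerMap (F : Hom L M) : LinearMap.ker L.src →ₗ[K] LinearMap.ker M.src :=
  (F.arr ∘ₗ (LinearMap.ker L.src).subtype).codRestrict _ (fun a => by simp)

@[simp] theorem Hom.coe_kerMap (F : Hom L M) (a : LinearMap.ker L.src) :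
    (F.kerMap a : M.Arr) = F.arr a := rfl

/-- The arrow parts of `map₂`. -/
def Hom.map₂Part (F : Hom L M) : L.Obj →ₗ[K] L.Obj →ₗ[K] LinearMap.ker M.src :=
  F.map₂.compr₂ M.arrowPart

theorem Hom.map₂Part_apply (F : Hom L M) (x y : L.Obj) :
    F.map₂Part x y = M.arrowPart (F.map₂ x y) := rfl

theorem Hom.arrowPart_arr (F : Hom L M) (f : L.Arr) :
    M.arrowPart (F.arr f) = F.kerMap (L.arrowPart f) := by
  ext; simp

theorem Hom.diff_kerMap (F : Hom L M) (a : LinearMap.ker L.src) :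
    M.diff (F.kerMap a) = F.obj (L.diff a) := F.tgt_arr a

theorem Hom.diff_map₂Part (F : Hom L M) (x y : L.Obj) :
    M.diff (F.map₂Part x y) = F.obj (L.brObj x y) - M.brObj (F.obj x) (F.obj y) := by
  rw [map₂Part_apply, diff_arrowPart]; simp

theorem Hom.map₂Part_skew (F : Hom L M) (x y : L.Obj) : F.map₂Part x y = - F.map₂Part y x := by
  rw [map₂Part_apply, map₂Part_apply, F.map₂_skew, map_neg]

theorem Hom.kerMap_kerAct (F : Hom L M) (x : L.Obj) (a : LinearMap.ker L.src) :
    F.kerMap (L.kerAct x a) = M.kerAct (F.obj x) (F.kerMap a) + F.map₂Part x (L.diff a) := by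
  have h := congrArg M.arrowPart (F.map₂_natural (L.idn x) a)
  simp only [arrowPart_comp, arrowPart_brArr, F.arrowPart_arr] at h
  simp [map₂Part_apply] at h ⊢
  exact h.symm

theorem Hom.kerMap_jacPart (F : Hom L M) (x y z : L.Obj) :
    F.kerMap (L.jacPart x y z) = M.jacPart (F.obj x) (F.obj y) (F.obj z)
      + M.kerAct (F.obj x) (F.map₂Part y z) - M.kerAct (F.obj y) (F.map₂Part x z)
      + M.kerAct (F.obj z) (F.map₂Part x y)
      + F.map₂Part x (L.brObj y z) + F.map₂Part (L.brObj x z) y - F.map₂Part (L.brObj x y) z := by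
  have h := congrArg M.arrowPart (F.map₂_jac x y z)
  simp only [arrowPart_comp, arrowPart_brArr, F.arrowPart_arr, map_add] at h
  simp [-TwoVectorSpace.coe_arrowPart, M.jac_eq, L.jac_eq, ← map₂Part_apply] at h
  linear_combination (norm := module) h

@[simp] theorem Hom.kerMap_id : (Hom.id L).kerMap = LinearMap.id := rfl

@[simp] theorem Hom.map₂Part_id : (Hom.id L).map₂Part = 0 := by
  ext x y; simp [Hom.map₂Part, Hom.id]

@[simp] theorem Hom.kerMap_comp {N : SemistrictLie2Algebra.{u, v} K} (F : Hom L M) (G : Hom M N)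
    (a : LinearMap.ker L.src) : (F.comp G).kerMap a = G.kerMap (F.kerMap a) := rfl

@[simp] theorem Hom.map₂Part_comp {N : SemistrictLie2Algebra.{u, v} K} (F : Hom L M) (G : Hom M N)
    (x y : L.Obj) : (F.comp G).map₂Part x y =
      G.map₂Part (F.obj x) (F.obj y) + G.kerMap (F.map₂Part x y) :=
  (arrowPart_comp _ _ _).trans (congrArg _ (G.arrowPart_arr _))

section

variable (F₀ : L.Obj →ₗ[K] M.Obj) (F₁ : LinearMap.ker L.src →ₗ[K] LinearMap.ker M.src)
    (F₂ : L.Obj →ₗ[K] L.Obj →ₗ[K] LinearMap.ker M.src) (h₁ h₂ h₃ h₄ h₅)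

@[simp] theorem Hom.obj_ofParts : (Hom.ofParts F₀ F₁ F₂ h₁ h₂ h₃ h₄ h₅).obj = F₀ := rfl

@[simp] theorem Hom.kerMap_ofParts : (Hom.ofParts F₀ F₁ F₂ h₁ h₂ h₃ h₄ h₅).kerMap = F₁ := by
  ext a; simp [Hom.ofParts, -TwoVectorSpace.coe_arrowPart]

@[simp] theorem Hom.map₂Part_ofParts :
    (Hom.ofParts F₀ F₁ F₂ h₁ h₂ h₃ h₄ h₅).map₂Part = F₂ := by
  ext x y; simp [Hom.map₂Part, Hom.ofParts, -TwoVectorSpace.coe_arrowPart]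

end

section Parts

variable {F G : Hom L M}

/-- A `2`-morphism from the arrow parts of its components. -/
def Hom₂.ofPart (h : L.Obj →ₗ[K] LinearMap.ker M.src)
    (diff_h : ∀ x, M.diff (h x) = G.obj x - F.obj x)
    (h_diff : ∀ a, G.kerMap a - F.kerMap a = h (L.diff a))
    (h_br : ∀ x y, F.map₂Part x y + h (L.brObj x y) =
      M.kerAct (G.obj x) (h y) - M.kerAct (F.obj y) (h x) + G.map₂Part x y) : Hom₂ F G where
  app := (LinearMap.ker M.src).subtype ∘ₗ h + M.idn ∘ₗ F.obj
  src_app x := by simp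
  tgt_app x := by simp [diff_h]
  natural f := by
    refine arr_ext (by simp) ?_
    have h1 := h_diff (L.arrowPart f)
    simp only [arrowPart_comp, F.arrowPart_arr, G.arrowPart_arr]
    simp [-TwoVectorSpace.coe_arrowPart, tgt_eq]
    linear_combination (norm := module) -h1
  app_br x y := by
    refine arr_ext (by simp) ?_
    have h1 := h_br x y
    simp only [Hom.map₂Part_apply] at h1
    simp only [arrowPart_comp, arrowPart_brArr]
    simp [-TwoVectorSpace.coe_arrowPart, diff_h]
    linear_combination (norm := module) h1

/-- The inverse of a `2`-morphism. -/
def Hom₂.inv (θ : Hom₂ F G) : Hom₂ G F where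
  app := M.idn ∘ₗ F.obj + M.idn ∘ₗ G.obj - θ.app
  src_app x := by simp
  tgt_app x := by simp
  natural f := by
    have h1 := θ.natural f
    simp only [M.comp_eq] at h1 ⊢
    simp at h1 ⊢
    linear_combination (norm := module) -h1
  app_br x y := by
    have h1 := congrArg M.arrowPart (θ.app_br x y)
    refine arr_ext (by simp) ?_
    simp only [arrowPart_comp, arrowPart_brArr] at h1 ⊢
    have h2 : ∀ z, G.obj z = F.obj z + M.diff (M.arrowPart (θ.app z)) := fun z => by
      rw [diff_arrowPart]; simp
    -- Inverting `θ` interchanges the values of `F` and `G` as acting objects. The two versions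
    -- differ by the actions of `d` of one arrow part on the other, and these cancel by
    -- skew-symmetry.
    have h3 := M.kerAct_diff (M.arrowPart (θ.app x)) (M.arrowPart (θ.app y))
    simp [-TwoVectorSpace.coe_arrowPart] at h1 ⊢
    rw [h2 x] at h1
    rw [h2 y]
    simp only [map_add, LinearMap.add_apply] at h1 ⊢
    linear_combination (norm := module) -h1 - h3

/-- Every `2`-morphism is invertible. -/
def Hom₂.toIso (θ : Hom₂ F G) : F ≅ G where
  hom := θ
  inv := θ.inv
  hom_inv_id := by
    apply Hom₂.ext
    ext x
    refine (Hom₂.app_comp (G := G) θ θ.inv x).trans ?_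
    simp [Hom₂.inv, Hom₂.app_id]
  inv_hom_id := by
    apply Hom₂.ext
    ext x
    refine (Hom₂.app_comp (G := F) θ.inv θ x).trans ?_
    simp [Hom₂.inv, Hom₂.app_id]

end Parts

end SemistrictLie2Algebra

/-! ### Equivalence of objects in a bicategory -/

namespace CategoryTheory.Bicategory

universe w₁ w₂ w₃

variable {B : Type w₁} [Bicategory.{w₂, w₃} B] {a b c : B}

/-- Equivalence of objects of a bicategory is symmetric. -/
theorem Equivalence.nonempty_symm (e : Equivalence a b) : Nonempty (Equivalence b a) :=
  ⟨Equivalence.mkOfAdjointifyCounit e.counit.symm e.unit.symm⟩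

/-- Equivalence of objects of a bicategory is transitive. -/
theorem Equivalence.nonempty_trans (e : Equivalence a b) (e' : Equivalence b c) :
    Nonempty (Equivalence a c) :=
  ⟨Equivalence.mkOfAdjointifyCounit (f := e.hom ≫ e'.hom) (g := e'.inv ≫ e.inv)
    (e.unit ≪≫ whiskerLeftIso e.hom ((λ_ _).symm ≪≫ whiskerRightIso e'.unit e.inv ≪≫ α_ _ _ _) ≪≫
      (α_ _ _ _).symm)
    (α_ _ _ _ ≪≫ whiskerLeftIso e'.inv ((α_ _ _ _).symm ≪≫ whiskerRightIso e.counit e'.hom ≪≫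
      λ_ _) ≪≫ e'.counit)⟩

end CategoryTheory.Bicategory

/-! ### A criterion for equivalences out of skeletal Lie `2`-algebras -/

namespace SemistrictLie2Algebra

variable {K : Type u} [Field K] {S M : SemistrictLie2Algebra.{u, v} K}

/-- A linear map with range in the range of `d` factors through `d`. -/
theorem exists_lift_of_range_le {U V W : Type*} [AddCommGroup U] [Module K U] [AddCommGroup V]
    [Module K V] [AddCommGroup W] [Module K W] (d : U →ₗ[K] W) (f : V →ₗ[K] W)
    (h : LinearMap.range f ≤ LinearMap.range d) : ∃ k : V →ₗ[K] U, ∀ x, d (k x) = f x := by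
  obtain ⟨g, hg⟩ := d.rangeRestrict.exists_rightInverse_of_surjective d.range_rangeRestrict
  refine ⟨g ∘ₗ f.codRestrict _ fun x => h (LinearMap.mem_range_self f x), fun x => ?_⟩
  exact congrArg Subtype.val (LinearMap.congr_fun hg (f.codRestrict _ _ x))

/-- A morphism from a skeletal semi-strict Lie `2`-algebra which is on objects a section of a
quotient map with kernel `im d`, and on `ker s` an isomorphism onto `ker d`, is an equivalence. -/
theorem Hom.exists_equivalence_of_isSkeletal (F : Hom S M) (hS : S.IsSkeletal)
    (q : M.Obj →ₗ[K] S.Obj) (hq : LinearMap.ker q = LinearMap.range M.diff)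
    (hqF : ∀ x, q (F.obj x) = x) (hinj : Function.Injective F.kerMap)
    (hsurj : LinearMap.ker M.diff ≤ LinearMap.range F.kerMap) :
    ∃ e : Bicategory.Equivalence S M, e.hom = F := by
  have hdS : ∀ a, S.diff a = 0 := fun a => by rw [hS]; rfl
  have hqd : ∀ a, q (M.diff a) = 0 := fun a => by
    have : M.diff a ∈ LinearMap.ker q := hq ▸ LinearMap.mem_range_self _ a
    exact this
  -- `F q - 1` is killed by `q`, hence takes values in `im d`: a contracting homotopy exists.
  obtain ⟨h', hh'⟩ := exists_lift_of_range_le M.diff (F.obj ∘ₗ q - LinearMap.id) (by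
    rw [← hq]
    rintro _ ⟨x, rfl⟩
    simp [hqF])
  -- The homotopy is normalized to vanish on the image of `F`, so that the unit of the equivalence
  -- can have zero arrow part.
  obtain ⟨h, hh, hhF⟩ : ∃ h : M.Obj →ₗ[K] LinearMap.ker M.src,
      (∀ x, M.diff (h x) = F.obj (q x) - x) ∧ ∀ x, h (F.obj x) = 0 :=
    ⟨h' - h' ∘ₗ F.obj ∘ₗ q, fun x => by simp [hh', hqF], fun x => by simp [hqF]⟩
  obtain ⟨ρ, hρ'⟩ := F.kerMap.exists_leftInverse_of_injective (LinearMap.ker_eq_bot.2 hinj)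
  have hρ : ∀ a, M.diff a = 0 → F.kerMap (ρ a) = a := fun a ha => by
    obtain ⟨b, rfl⟩ := hsurj ha
    exact congrArg F.kerMap (LinearMap.congr_fun hρ' b)
  -- Replacing `x` and `y` by `F (q x)` and `F (q y)` changes the bracket by boundaries, and `F`
  -- preserves brackets up to a boundary; `q` kills all of these.
  have hqbr : ∀ x y, S.brObj (q x) (q y) = q (M.brObj x y) := fun x y => by
    have h1 := hqd (F.map₂Part (q x) (q y))
    have h2 := hqd (M.kerAct (F.obj (q x)) (h y))
    have h3 := hqd (M.kerAct y (h x))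
    rw [F.diff_map₂Part] at h1
    rw [diff_kerAct, hh] at h2 h3
    simp only [map_sub, hqF] at h1 h2 h3
    rw [M.brObj_skew y, M.brObj_skew y] at h3
    simp only [map_neg] at h3
    linear_combination (norm := module) h1 + h2 - h3
  -- The inverse morphism is forced by requiring `h` to be the arrow part of a `2`-morphism from the
  -- identity to the composite of `G` and `F`. Compatibility with brackets prescribes the image of
  -- `g₂` under `F.kerMap`, and naturality prescribes that of `r`. Both prescribed values lie in
  -- `ker d`, where `ρ` inverts `F.kerMap`.
  let g₂ : M.Obj →ₗ[K] M.Obj →ₗ[K] LinearMap.ker S.src :=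
    (M.brObj.compr₂ h - F.map₂Part.compl₁₂ q q - (M.kerAct ∘ₗ F.obj ∘ₗ q).compl₂ h
      + (M.kerAct.compl₂ h).flip).compr₂ ρ
  have hg : ∀ x y, F.kerMap (g₂ x y) = h (M.brObj x y) - F.map₂Part (q x) (q y)
      - M.kerAct (F.obj (q x)) (h y) + M.kerAct y (h x) := fun x y => by
    refine hρ _ ?_
    simp [diff_kerAct, hh, F.diff_map₂Part, hqbr]
    rw [M.brObj_skew y (F.obj _), M.brObj_skew y x]
    abel
  let r : LinearMap.ker M.src →ₗ[K] LinearMap.ker S.src := ρ ∘ₗ (LinearMap.id + h ∘ₗ M.diff)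
  have hr : ∀ a, F.kerMap (r a) = a + h (M.diff a) := fun a => hρ _ (by simp [hh, hqd])
  -- Acting by `F (q u)` instead of `u` adds the action of `d (h u)`, which can be traded for the
  -- action of `d a` on `h u`.
  have hX : ∀ u a, M.kerAct (F.obj (q u)) a - M.kerAct u a = - M.kerAct (M.diff a) (h u) :=
    fun u a => by
      rw [← kerAct_diff, hh, map_sub, LinearMap.sub_apply]
  have hXX : ∀ u v, M.kerAct (F.obj (q u)) (h v) - M.kerAct u (h v) =
      M.kerAct v (h u) - M.kerAct (F.obj (q v)) (h u) := fun u v => by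
    rw [hX, hh, map_sub, LinearMap.sub_apply, neg_sub]
  let G : Hom M S := Hom.ofParts q r g₂ (fun a => by rw [hdS, hqd])
    (fun x y => by rw [hdS, hqbr, sub_self])
    (fun x y => hinj (by
      rw [map_neg, hg, hg, F.map₂Part_skew, M.brObj_skew x y, map_neg]
      linear_combination (norm := module) - hXX x y))
    (fun x a => hinj (by
      rw [map_add, hr, F.kerMap_kerAct, hr, hg, hdS, diff_kerAct, hqd]
      simp only [map_add, map_zero]
      linear_combination (norm := module) - hX x a))
    (fun x y z => hinj (by
      simp only [map_add, map_sub, hr, F.kerMap_kerAct, F.kerMap_jacPart, hdS, hg, map_zero, hqbr,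
        diff_jacPart]
      -- The axioms of `G` are checked after applying the injective `F.kerMap`. The Jacobiator at `F
      -- q x, F q y, F q z` is compared with that at `x, y, z` by changing one argument at a time,
      -- each change being `d` of a value of `h`. `hX` and `hXX` absorb the remaining changes of
      -- acting object.
      have h1 := M.jacPart_diff (F.obj (q x)) (F.obj (q y)) (h z)
      have h2 := M.jacPart_diff (F.obj (q x)) z (h y)
      have h3 := M.jacPart_diff y z (h x)
      have h4 := hX z (M.kerAct (F.obj (q x)) (h y))
      have h5 := hX y (M.kerAct z (h x))
      have h6 := hX z (M.kerAct y (h x))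
      have h7 := hXX y (M.brObj x z)
      have h8 := hXX z (M.brObj x y)
      rw [hh] at h1 h2 h3
      rw [diff_kerAct, hh] at h4 h5 h6
      rw [M.jacPart_right (F.obj (q x)) z] at h2
      rw [M.jacPart_right y z, M.jacPart_left y] at h3
      simp only [map_sub, LinearMap.sub_apply] at h1 h2 h3 h4 h5 h6
      rw [M.brObj_skew z (F.obj (q x)), M.brObj_skew z x] at h5
      rw [M.brObj_skew y (F.obj (q x)), M.brObj_skew y x] at h6
      simp only [map_neg, LinearMap.neg_apply] at h5 h6
      linear_combination (norm := module) -h1 + h2 - h3 + h4 + h5 - h6 + h7 - h8))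
  -- On objects `q` is a strict left inverse of `F`. The bracket condition for the zero arrow part
  -- is where `h ∘ F = 0` is used.
  let η : Hom₂ (Hom.id S) (F.comp G) := Hom₂.ofPart 0
    (fun x => by
      rw [LinearMap.zero_apply, map_zero]
      exact (sub_eq_zero.2 (hqF x)).symm)
    (fun a => hinj (by simp [G, hr, F.diff_kerMap, hdS]))
    (fun x y => hinj (by simp [G, hr, hg, F.diff_map₂Part, hqF, hhF]; abel))
  let ε : Hom₂ (Hom.id M) (G.comp F) := Hom₂.ofPart h hh (fun a => by simp [G, hr])
    (fun x y => by
      simp [G, hg, Hom.comp_obj, Hom.id_obj]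
      abel)
  exact ⟨Bicategory.Equivalence.mkOfAdjointifyCounit (f := F) (g := G) η.toIso ε.toIso.symm, rfl⟩

end SemistrictLie2Algebra

/-- The cocycle of a skeletal semi-strict Lie `2`-algebra. -/
def SemistrictLie2Algebra.lieThreeCocycle {K : Type u} [Field K]
    (S : SemistrictLie2Algebra.{u, v} K) (hS : S.IsSkeletal) :
    LieThreeCocycle K S.Obj (LinearMap.ker S.src) where
  br := S.brObj
  act := S.kerAct
  c := S.jacPart
  br_skew := S.brObj_skew
  jacobi x y z := by
    have h := S.diff_jacPart x y z
    rw [hS, LinearMap.zero_apply] at h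
    exact (sub_eq_zero.1 h.symm).symm
  act_br x y a := by
    have h := S.jacPart_diff x y a
    rw [hS, LinearMap.zero_apply, map_zero] at h
    exact (sub_eq_zero.1 h.symm).symm
  c_left := S.jacPart_left
  c_right := S.jacPart_right
  cocycle := S.jacPart_cocycle

/-! ### The skeletal Lie `2`-algebra of a `3`-cocycle -/

namespace LieThreeCocycle

variable {K : Type u} [Field K] {g V : Type v} [AddCommGroup g] [Module K g] [AddCommGroup V]
  [Module K V] (T : LieThreeCocycle K g V)

/-- The `2`-vector space with objects `g` and arrows `V × g`, all of them endomorphisms. -/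
def skeletalTwoVectorSpace (K : Type u) [Field K] (g V : Type v) [AddCommGroup g] [Module K g]
    [AddCommGroup V] [Module K V] : TwoVectorSpace.{u, v} K where
  Obj := g
  Arr := V × g
  src := LinearMap.snd K V g
  tgt := LinearMap.snd K V g
  idn := LinearMap.inr K V g
  comp a b _ := (a.1 + b.1, a.2)
  src_idn _ := rfl
  tgt_idn _ := rfl
  src_comp _ _ _ := rfl
  tgt_comp _ _ h := h
  comp_add a b a' b' _ _ := by ext <;> simp; abel
  comp_smul t a b _ := by ext <;> simp
  idn_comp _ := by ext <;> simp
  comp_idn _ := by ext <;> simp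
  comp_assoc _ _ _ _ _ := by ext <;> simp; abel

/-- The bracket on arrows of the skeletal Lie `2`-algebra of a cocycle. -/
def skeletalBr : (V × g) →ₗ[K] (V × g) →ₗ[K] V × g :=
  LinearMap.mk₂ K (fun a b => (T.act a.2 b.1 - T.act b.2 a.1, T.br a.2 b.2))
    (fun a a' b => by ext <;> simp; abel) (fun t a b => by ext <;> simp [smul_sub])
    (fun a a' b => by ext <;> simp; abel) (fun t a b => by ext <;> simp [smul_sub])

@[simp] theorem skeletalBr_apply (a b : V × g) :
    T.skeletalBr a b = (T.act a.2 b.1 - T.act b.2 a.1, T.br a.2 b.2) := rfl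

/-- The Jacobiator of the skeletal Lie `2`-algebra of a cocycle. -/
def skeletalJac : g →ₗ[K] g →ₗ[K] g →ₗ[K] V × g where
  toFun x := LinearMap.mk₂ K (fun y z => (T.c x y z, T.br (T.br x y) z))
    (fun y y' z => by simp) (fun t y z => by simp) (fun y z z' => by simp) (fun t y z => by simp)
  map_add' x y := by ext <;> simp
  map_smul' t x := by ext <;> simp

@[simp] theorem skeletalJac_apply (x y z : g) :
    T.skeletalJac x y z = (T.c x y z, T.br (T.br x y) z) := rfl

/-- The skeletal Lie `2`-algebra of a cocycle, without the axioms on the Jacobiator. -/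
def skeletalPre : PreLie2Algebra.{u, v} K where
  toTwoVectorSpace := skeletalTwoVectorSpace K g V
  brObj := (T.br : g →ₗ[K] g →ₗ[K] g)
  brArr := (T.skeletalBr : (V × g) →ₗ[K] (V × g) →ₗ[K] V × g)
  src_brArr _ _ := rfl
  tgt_brArr _ _ := rfl
  brArr_idn x y := by
    change T.skeletalBr (0, x) (0, y) = (0, T.br x y)
    simp
  brArr_comp := fun (a a' b b' : V × g) (h : a.2 = a'.2) (h' : b.2 = b'.2) =>
    show T.skeletalBr (a.1 + a'.1, a.2) (b.1 + b'.1, b.2) =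
      ((T.skeletalBr a b).1 + (T.skeletalBr a' b').1, (T.skeletalBr a b).2) by
    simp [h, h']
    abel
  brObj_skew := T.br_skew
  brArr_skew := fun (a b : V × g) => show T.skeletalBr a b = - T.skeletalBr b a by
    ext
    · simp
    · simpa using T.br_skew a.2 b.2
  jac := (T.skeletalJac : g →ₗ[K] g →ₗ[K] g →ₗ[K] V × g)
  src_jac x y z := congrArg Prod.snd (T.skeletalJac_apply x y z)
  tgt_jac x y z := (congrArg Prod.snd (T.skeletalJac_apply x y z)).trans (T.jacobi x y z)

/-- The skeletal Lie `2`-algebra of a cocycle. -/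
def skeletal : SemistrictLie2Algebra.{u, v} K where
  toPreLie2Algebra := T.skeletalPre
  isSemistrict :=
    { jac_natural := fun a b k => by
        obtain ⟨a, x⟩ := a
        obtain ⟨b, y⟩ := b
        obtain ⟨k, z⟩ := k
        change ((T.skeletalBr (T.skeletalBr (a, x) (b, y)) (k, z)).1 + (T.skeletalJac x y z).1,
            (T.skeletalBr (T.skeletalBr (a, x) (b, y)) (k, z)).2) =
          ((T.skeletalJac x y z).1 + (T.skeletalBr (a, x) (T.skeletalBr (b, y) (k, z)) +
            T.skeletalBr (T.skeletalBr (a, x) (k, z)) (b, y)).1, (T.skeletalJac x y z).2)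
        ext
        · simp [T.act_br]
          abel
        · simp
      jac_antisymm_left := fun (x y z : g) => Subtype.ext
        (show (T.c x y z, T.br (T.br x y) z) - ((0 : V), T.br (T.br x y) z) =
          -((T.c y x z, T.br (T.br y x) z) - (0, T.br (T.br y x) z)) by
          simpa using T.c_left x y z)
      jac_antisymm_right := fun (x y z : g) => Subtype.ext
        (show (T.c x y z, T.br (T.br x y) z) - ((0 : V), T.br (T.br x y) z) =
          -((T.c x z y, T.br (T.br x z) y) - (0, T.br (T.br x z) y)) by
          simpa using T.c_right x y z)
      jacobiator_identity := fun (w x y z : g) => Prod.ext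
        (show T.c (T.br w x) y z + (T.act (T.br (T.br w x) z) 0 - T.act y (T.c w x z) + 0)
            + (T.c w (T.br x z) y + T.c (T.br w z) x y + T.c w x (T.br y z)) =
          T.act (T.br (T.br w x) y) 0 - T.act z (T.c w x y)
            + (T.c (T.br w y) x z + T.c w (T.br x y) z)
            + (T.act (T.br (T.br w y) z) 0 - T.act x (T.c w y z) + 0)
            + (T.act w (T.c x y z) - T.act (T.br (T.br x y) z) 0 + 0) by
          have h := T.cocycle w x y z
          rw [T.c_right w (T.br x z) y, T.c_left w y (T.br x z), T.c_right y w (T.br x z),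
            T.c_left y (T.br x z) w, T.c_right (T.br x z) y w, T.c_right w x (T.br y z),
            T.c_left w (T.br y z) x, T.c_left w (T.br x y) z]
          simp only [map_zero]
          linear_combination (norm := module) -h)
        rfl }

theorem isSkeletal_skeletal : T.skeletal.IsSkeletal :=
  LinearMap.ext fun a => a.2

/-- The arrows with source `0` of the skeletal Lie `2`-algebra of a cocycle. -/
def skeletalKer : LinearMap.ker T.skeletal.src ≃ₗ[K] V where
  toFun a := Prod.fst (α := V) (β := g) a.1
  map_add' _ _ := rfl
  map_smul' _ _ := rfl
  invFun w := ⟨((w, 0) : V × g), rfl⟩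
  left_inv a := Subtype.ext (Prod.ext rfl (Eq.symm a.2))
  right_inv _ := rfl

theorem skeletalKer_kerAct (x : T.skeletal.Obj) (a : LinearMap.ker T.skeletal.src) :
    T.skeletalKer (T.skeletal.kerAct x a) = T.act x (T.skeletalKer a) := by
  obtain ⟨⟨a, y⟩, h⟩ := a
  change T.act x a - T.act y 0 = T.act x a
  simp

theorem skeletalKer_jacPart (x y z : T.skeletal.Obj) :
    T.skeletalKer (T.skeletal.jacPart x y z) = T.c x y z := by
  change T.c x y z - (0 : V) = T.c x y z
  simp

variable {M : SemistrictLie2Algebra.{u, v} K}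

/-- A morphism from the skeletal Lie `2`-algebra of a cocycle. -/
def skeletalHom (f₀ : g →ₗ[K] M.Obj) (f₁ : V →ₗ[K] LinearMap.ker M.src)
    (f₂ : g →ₗ[K] g →ₗ[K] LinearMap.ker M.src)
    (diff_f₁ : ∀ a, M.diff (f₁ a) = 0)
    (diff_f₂ : ∀ x y, M.diff (f₂ x y) = f₀ (T.br x y) - M.brObj (f₀ x) (f₀ y))
    (f₂_skew : ∀ x y, f₂ x y = - f₂ y x)
    (f₁_act : ∀ x a, f₁ (T.act x a) = M.kerAct (f₀ x) (f₁ a))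
    (f₁_c : ∀ x y z, f₁ (T.c x y z) = M.jacPart (f₀ x) (f₀ y) (f₀ z)
      + M.kerAct (f₀ x) (f₂ y z) - M.kerAct (f₀ y) (f₂ x z) + M.kerAct (f₀ z) (f₂ x y)
      + f₂ x (T.br y z) + f₂ (T.br x z) y - f₂ (T.br x y) z) :
    SemistrictLie2Algebra.Hom T.skeletal M :=
  SemistrictLie2Algebra.Hom.ofParts (L := T.skeletal)
    (id f₀ : T.skeletal.Obj →ₗ[K] M.Obj) (f₁ ∘ₗ T.skeletalKer.toLinearMap)
    (id f₂ : T.skeletal.Obj →ₗ[K] T.skeletal.Obj →ₗ[K] LinearMap.ker M.src)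
    (fun a => by
      rw [T.isSkeletal_skeletal, LinearMap.zero_apply, map_zero]
      exact diff_f₁ _)
    diff_f₂ f₂_skew
    (fun x a => by
      rw [T.isSkeletal_skeletal, LinearMap.zero_apply, map_zero, add_zero]
      exact (congrArg f₁ (T.skeletalKer_kerAct x a)).trans (f₁_act x _))
    (fun x y z => (congrArg f₁ (T.skeletalKer_jacPart x y z)).trans (f₁_c x y z))

theorem kerMap_skeletalHom (f₀ : g →ₗ[K] M.Obj) (f₁ : V →ₗ[K] LinearMap.ker M.src)
    (f₂ : g →ₗ[K] g →ₗ[K] LinearMap.ker M.src) (h₁ h₂ h₃ h₄ h₅)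
    (a : LinearMap.ker T.skeletal.src) :
    (T.skeletalHom f₀ f₁ f₂ h₁ h₂ h₃ h₄ h₅).kerMap a = f₁ (T.skeletalKer a) :=
  LinearMap.congr_fun
    (SemistrictLie2Algebra.Hom.kerMap_ofParts (L := T.skeletal) _ _ _ _ _ _ _ _) a

end LieThreeCocycle

/-! ### Homotopy transfer to the cohomology -/

namespace SemistrictLie2Algebra

variable {K : Type u} [Field K] (L : SemistrictLie2Algebra.{u, v} K)

section Transfer

variable {W : Type*} [AddCommGroup W] [Module K W] (σ : W →ₗ[K] L.Obj) (b : W →ₗ[K] W →ₗ[K] W)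
  (H : W →ₗ[K] W →ₗ[K] LinearMap.ker L.src)

/-- The Jacobiator transferred along a linear map `σ` which preserves brackets up to `H`. -/
def transferJac : W →ₗ[K] W →ₗ[K] W →ₗ[K] LinearMap.ker L.src where
  toFun x := LinearMap.mk₂ K (fun y z => L.jacPart (σ x) (σ y) (σ z)
      + L.kerAct (σ x) (H y z) - L.kerAct (σ y) (H x z) + L.kerAct (σ z) (H x y)
      + H x (b y z) + H (b x z) y - H (b x y) z)
    (fun y y' z => by simp; abel) (fun t y z => by simp; module) (fun y z z' => by simp; abel)
    (fun t y z => by simp; module)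
  map_add' x y := by ext; simp; abel
  map_smul' t x := by ext; simp; module

theorem transferJac_apply (x y z : W) : L.transferJac σ b H x y z = L.jacPart (σ x) (σ y) (σ z)
      + L.kerAct (σ x) (H y z) - L.kerAct (σ y) (H x z) + L.kerAct (σ z) (H x y)
      + H x (b y z) + H (b x z) y - H (b x y) z := rfl

variable {σ b H} (b_skew : ∀ x y, b x y = - b y x)
  (jacobi : ∀ x y z, b (b x y) z = b x (b y z) + b (b x z) y)
  (H_skew : ∀ x y, H x y = - H y x)
  (hσ : ∀ x y, σ (b x y) = L.brObj (σ x) (σ y) + L.diff (H x y))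

include b_skew H_skew in
theorem transferJac_left (x y z : W) :
    L.transferJac σ b H x y z = - L.transferJac σ b H y x z := by
  rw [transferJac_apply, transferJac_apply, L.jacPart_left, H_skew x (b y z), H_skew (b x z) y,
    H_skew x y, b_skew x y]
  simp
  abel

include b_skew H_skew in
theorem transferJac_right (x y z : W) :
    L.transferJac σ b H x y z = - L.transferJac σ b H x z y := by
  rw [transferJac_apply, transferJac_apply, L.jacPart_right, H_skew y z, b_skew y z]
  simp
  abel

-- The correction terms in `H` turn the Jacobi defect of `L₀` at the lifts into `σ` of the Jacobi
-- defect of `b`, which is zero. Hence the transferred Jacobiator takes values in `ker d`.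
include jacobi hσ in
theorem diff_transferJac (x y z : W) : L.diff (L.transferJac σ b H x y z) = 0 := by
  have hH : ∀ x y, L.diff (H x y) = σ (b x y) - L.brObj (σ x) (σ y) := fun x y => by
    rw [hσ]; abel
  have h := congrArg σ (jacobi x y z)
  rw [transferJac_apply]
  simp only [map_add, map_sub, diff_kerAct, diff_jacPart, hH] at h ⊢
  rw [h, L.brObj_skew (σ z) (σ (b x y)), L.brObj_skew (σ (b x z)) (σ y),
    L.brObj_skew (L.brObj (σ x) (σ z)) (σ y), L.brObj_skew (L.brObj (σ x) (σ y)) (σ z)]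
  abel

-- Expand `σ (b x y)` as a bracket plus `d H`. The terms without `H` are the cocycle identity of
-- `L`. The double actions on `H` cancel against Jacobiators with an argument `d H`; the actions of
-- `d H` on `H` cancel in pairs by `kerAct_diff`; the terms with nested `b` inside `H` cancel by the
-- Jacobi identity.
set_option maxHeartbeats 1000000 in
include b_skew jacobi H_skew hσ in
theorem transferJac_cocycle (w x y z : W) :
    L.kerAct (σ w) (L.transferJac σ b H x y z) - L.kerAct (σ x) (L.transferJac σ b H w y z)
      + L.kerAct (σ y) (L.transferJac σ b H w x z) - L.kerAct (σ z) (L.transferJac σ b H w x y)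
      - L.transferJac σ b H (b w x) y z + L.transferJac σ b H (b w y) x z
      - L.transferJac σ b H (b w z) x y - L.transferJac σ b H (b x y) w z
      + L.transferJac σ b H (b x z) w y - L.transferJac σ b H (b y z) w x = 0 := by
  have hj : ∀ u v a, L.jacPart (L.diff a) u v =
      L.kerAct u (L.kerAct v a) - L.kerAct v (L.kerAct u a) - L.kerAct (L.brObj u v) a :=
    fun u v a => by
      rw [← L.jacPart_diff, L.jacPart_right u v, L.jacPart_left u, neg_neg]
  have h0 := L.jacPart_cocycle (σ w) (σ x) (σ y) (σ z)
  have h1 := L.kerAct_diff (H w x) (H y z)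
  have h2 := L.kerAct_diff (H w y) (H x z)
  have h3 := L.kerAct_diff (H w z) (H x y)
  have k1 := congrArg (fun t => H t z) (jacobi w x y)
  have k2 := congrArg (fun t => H t y) (jacobi w x z)
  have k3 := congrArg (fun t => H t x) (jacobi w y z)
  have k4 := congrArg (fun t => H t w) (jacobi x y z)
  simp only [transferJac_apply, hσ, map_add, map_sub, LinearMap.add_apply, hj] at k1 k2 k3 k4 ⊢
  rw [b_skew (b x y) w, b_skew (b x z) w, b_skew (b y z) w, b_skew (b y z) x]
  rw [H_skew w (b y z), H_skew w (b x z), H_skew w (b x y), H_skew x (b y z)]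
  rw [H_skew (b w x) (b y z), H_skew (b w y) (b x z), H_skew (b w z) (b x y)]
  simp only [map_neg, LinearMap.neg_apply]
  linear_combination (norm := module) h0 + k1 - k2 + k3 - k4 - h1 + h2 - h3

end Transfer

end SemistrictLie2Algebra

/-! ### Existence of skeletal models -/

namespace SemistrictLie2Algebra

variable {K : Type u} [Field K] (L : SemistrictLie2Algebra.{u, v} K)

/-- A semi-strict Lie `2`-algebra has a skeletal model. -/
theorem exists_isSkeletalModel : ∃ S : SemistrictLie2Algebra.{u, v} K, S.IsSkeletalModel L := by
  obtain ⟨W, _, _, q, hqker, hqsurj⟩ : ∃ (W : Type v) (_ : AddCommGroup W) (_ : Module K W)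
      (q : L.Obj →ₗ[K] W), LinearMap.ker q = LinearMap.range L.diff ∧ Function.Surjective q :=
    ⟨_, _, _, (LinearMap.range L.diff).mkQ, Submodule.ker_mkQ _, Submodule.mkQ_surjective _⟩
  have hqd : ∀ a, q (L.diff a) = 0 := fun a => by
    have : L.diff a ∈ LinearMap.ker q := hqker ▸ LinearMap.mem_range_self _ a
    exact this
  obtain ⟨σ, hσ'⟩ := q.exists_rightInverse_of_surjective (LinearMap.range_eq_top.2 hqsurj)
  have hqσ : ∀ x, q (σ x) = x := fun x => LinearMap.congr_fun hσ' x
  obtain ⟨h, hh⟩ := exists_lift_of_range_le L.diff (σ ∘ₗ q - LinearMap.id) (by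
    rw [← hqker]
    rintro _ ⟨x, rfl⟩
    simp [hqσ])
  replace hh : ∀ x, L.diff (h x) = σ (q x) - x := hh
  obtain ⟨b, hb⟩ : ∃ b : W →ₗ[K] W
      →ₗ[K] W, ∀ x y, b x y = q (L.brObj (σ x) (σ y)) :=
    ⟨(L.brObj.compl₁₂ σ σ).compr₂ q, fun _ _ => rfl⟩
  -- The homotopy applied to the bracket of lifts measures how far `σ` is from preserving brackets.
  obtain ⟨H, hH⟩ : ∃ H : W →ₗ[K] W
      →ₗ[K] LinearMap.ker L.src, ∀ x y, H x y = h (L.brObj (σ x) (σ y)) :=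
    ⟨(L.brObj.compl₁₂ σ σ).compr₂ h, fun _ _ => rfl⟩
  have hσ : ∀ x y, σ (b x y) = L.brObj (σ x) (σ y) + L.diff (H x y) := fun x y => by
    rw [hH, hh, hb]; abel
  have b_skew : ∀ x y, b x y = - b y x := fun x y => by
    rw [hb, hb, L.brObj_skew, map_neg]
  have H_skew : ∀ x y, H x y = - H y x := fun x y => by
    rw [hH, hH, L.brObj_skew, map_neg]
  have hqr : ∀ x a, q (L.brObj x (L.diff a)) = 0 := fun x a => by rw [← diff_kerAct, hqd]
  have hql : ∀ x a, q (L.brObj (L.diff a) x) = 0 := fun x a => by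
    rw [L.brObj_skew, map_neg, hqr, neg_zero]
  -- The Jacobi defect in `L₀` is a boundary, and brackets with boundaries are boundaries; `q` kills
  -- both.
  have jacobi : ∀ x y z, b (b x y) z = b x (b y z) + b (b x z) y := fun x y z => by
    have h1 := hqd (L.jacPart (σ x) (σ y) (σ z))
    rw [diff_jacPart] at h1
    rw [hb (b x y) z, hb x (b y z), hb (b x z) y, hσ, hσ, hσ]
    simp only [map_add, map_sub, LinearMap.add_apply, hqr, hql] at h1 ⊢
    linear_combination (norm := module) -h1
  -- A linear retraction onto `ker d`: composing with it makes the action and the transferred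
  -- Jacobiator, whose values already lie there, into multilinear maps to `ker d`.
  obtain ⟨ρ, hρ'⟩ := (LinearMap.ker L.diff).subtype.exists_leftInverse_of_injective
    (Submodule.ker_subtype _)
  have hρ : ∀ a, L.diff a = 0 → (ρ a : LinearMap.ker L.src) = a := fun a ha =>
    congrArg Subtype.val (LinearMap.congr_fun hρ' ⟨a, ha⟩)
  have hJ : ∀ x y z, (ρ (L.transferJac σ b H x y z) : LinearMap.ker L.src) =
      L.transferJac σ b H x y z := fun x y z => hρ _ (L.diff_transferJac jacobi hσ x y z)
  have hA : ∀ x (a : LinearMap.ker L.diff), (ρ (L.kerAct (σ x) a) : LinearMap.ker L.src) =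
      L.kerAct (σ x) a := fun x a => hρ _ (by rw [diff_kerAct, a.2, map_zero])
  have hA' : ∀ w x y z, (ρ (L.kerAct (σ w) (L.transferJac σ b H x y z)) : LinearMap.ker L.src) =
      L.kerAct (σ w) (L.transferJac σ b H x y z) := fun w x y z => by rw [← hJ, hA]
  let T : LieThreeCocycle K W (LinearMap.ker L.diff) :=
    { br := b
      act := ((L.kerAct ∘ₗ σ).compl₂ (LinearMap.ker L.diff).subtype).compr₂ ρ
      c :=
        { toFun := fun x => (L.transferJac σ b H x).compr₂ ρ
          map_add' := fun x y => by ext; simp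
          map_smul' := fun t x => by ext; simp }
      br_skew := b_skew
      jacobi := jacobi
      act_br := fun x y a => Subtype.ext (by
        -- For `a` in `ker d` both obstructions to a module structure vanish: the Jacobiator at `d
        -- a`, and the action of `d (H x y)` on `a`.
        have h1 := L.jacPart_diff (σ x) (σ y) a
        have h2 := L.kerAct_diff (H x y) a
        have ha : L.diff (a : LinearMap.ker L.src) = 0 := a.2
        rw [ha, map_zero] at h1 h2
        rw [LinearMap.zero_apply, neg_zero] at h2
        change (ρ (L.kerAct (σ (b x y)) a) : LinearMap.ker L.src) =
          ρ (L.kerAct (σ x) (ρ (L.kerAct (σ y) a) : LinearMap.ker L.diff)) -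
          ρ (L.kerAct (σ y) (ρ (L.kerAct (σ x) a) : LinearMap.ker L.diff))
        rw [hA, hA, hA, hA, hA, hσ, map_add, LinearMap.add_apply, h2, add_zero]
        exact (sub_eq_zero.1 h1.symm).symm)
      c_left := fun x y z => by
        change ρ _ = - ρ _
        rw [L.transferJac_left b_skew H_skew, map_neg]
      c_right := fun x y z => by
        change ρ _ = - ρ _
        rw [L.transferJac_right b_skew H_skew, map_neg]
      cocycle := fun w x y z => Subtype.ext (by
        have h1 := L.transferJac_cocycle b_skew jacobi H_skew hσ w x y z
        simp only [LinearMap.coe_mk, AddHom.coe_mk, LinearMap.compr₂_apply, LinearMap.compl₂_apply,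
          LinearMap.comp_apply, Submodule.subtype_apply, AddSubgroupClass.coe_sub,
          Submodule.coe_add, hA', hJ]
        exact h1) }
  let F : Hom T.skeletal L := T.skeletalHom σ (LinearMap.ker L.diff).subtype H
    (fun a => a.2) (fun x y => (sub_eq_iff_eq_add'.2 (hσ x y)).symm) H_skew hA hJ
  have hF : ∀ a, F.kerMap a = T.skeletalKer a := fun a => T.kerMap_skeletalHom _ _ _ _ _ _ _ _ a
  obtain ⟨e, he⟩ := F.exists_equivalence_of_isSkeletal T.isSkeletal_skeletal q hqker hqσ
    (fun a a' h => T.skeletalKer.injective (Subtype.ext (by rw [← hF, ← hF, h])))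
    (fun a ha => ⟨T.skeletalKer.symm ⟨a, ha⟩, by simp [hF]⟩)
  refine ⟨T.skeletal, T.isSkeletal_skeletal, e, ⟨q, hqsurj, hqker, fun x => ?_⟩, ?_⟩
  · rw [he]; exact hqσ x
  · rw [he]
    refine ⟨fun a ha => ?_, fun a ha a' ha' h => ?_, fun a ha => ?_⟩
    · exact ⟨(F.kerMap ⟨a, ha⟩).2, (congrArg L.diff (hF ⟨a, ha⟩)).trans (T.skeletalKer _).2⟩
    · have h1 : F.kerMap ⟨a, ha⟩ = F.kerMap ⟨a', ha'⟩ := Subtype.ext h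
      rw [hF, hF] at h1
      exact congrArg Subtype.val (T.skeletalKer.injective (Subtype.ext h1))
    · refine ⟨(T.skeletalKer.symm ⟨⟨a, ha.1⟩, ha.2⟩ : LinearMap.ker T.skeletal.src), ?_, ?_⟩
      · exact (T.skeletalKer.symm ⟨⟨a, ha.1⟩, ha.2⟩ : LinearMap.ker T.skeletal.src).2
      · exact congrArg Subtype.val ((hF _).trans (congrArg Subtype.val
          (T.skeletalKer.apply_symm_apply ⟨⟨a, ha.1⟩, ha.2⟩)))

end SemistrictLie2Algebra

/-! ### Comparison with the strict Lie `2`-algebra of a realizing crossed module -/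

namespace LieCrossedModule

open SemistrictLie2Algebra

variable {K : Type u} [Field K] (X : LieCrossedModule.{u, v} K)

/-- The elements of `H` as arrows with source `0`. -/
def toKer : X.H →ₗ[K] LinearMap.ker X.toStrict.toSemistrict.src where
  toFun h := ⟨(⟨h, 0⟩ : LieAlgebra.SemiDirectSum X.H X.G X.act), rfl⟩
  map_add' h h' := Subtype.ext (show (⟨h + h', 0⟩ : LieAlgebra.SemiDirectSum X.H X.G X.act) =
    ⟨h, 0⟩ + ⟨h', 0⟩ by simp)
  map_smul' t h := Subtype.ext (show (⟨t • h, 0⟩ : LieAlgebra.SemiDirectSum X.H X.G X.act) =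
    t • ⟨h, 0⟩ by simp)

theorem toKer_injective : Function.Injective X.toKer := fun _ _ h =>
  congrArg LieAlgebra.SemiDirectSum.left (congrArg Subtype.val h)

theorem toKer_surjective : Function.Surjective X.toKer := fun a =>
  ⟨LieAlgebra.SemiDirectSum.left a.1, Subtype.ext
    (LieAlgebra.SemiDirectSum.ext rfl (Eq.symm a.2))⟩

/-- The objects of the strict Lie `2`-algebra of `X`. -/
def toObj : X.G →ₗ[K] X.toStrict.toSemistrict.Obj := LinearMap.id (M := X.G)

theorem brObj_toObj (a b : X.G) :
    X.toStrict.toSemistrict.brObj (X.toObj a) (X.toObj b) = X.toObj ⁅a, b⁆ := rfl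

theorem diff_toKer (h : X.H) : X.toStrict.toSemistrict.diff (X.toKer h) = X.toObj (X.μ h) :=
  add_zero (X.μ h)

theorem kerAct_toKer (a : X.G) (h : X.H) :
    X.toStrict.toSemistrict.kerAct (X.toObj a) (X.toKer h) = X.toKer (X.act a h) := by
  refine Subtype.ext ?_
  change ⁅(⟨0, a⟩ : LieAlgebra.SemiDirectSum X.H X.G X.act),
    (⟨h, 0⟩ : LieAlgebra.SemiDirectSum X.H X.G X.act)⁆ = ⟨X.act a h, 0⟩
  simp

theorem jacPart_toObj (a b c : X.G) :
    X.toStrict.toSemistrict.jacPart (X.toObj a) (X.toObj b) (X.toObj c) = 0 :=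
  X.toStrict.toSemistrict.arrowPart_idn _

/-- A skeletal semi-strict Lie `2`-algebra is equivalent to the strict Lie `2`-algebra of a crossed
module which realizes its triple. -/
theorem Realizes.nonempty_equivalence {X : LieCrossedModule.{u, v} K}
    {S : SemistrictLie2Algebra.{u, v} K} (hX : X.Realizes S) (hS : S.IsSkeletal) :
    Nonempty (Bicategory.Equivalence S X.toStrict.toSemistrict) := by
  obtain ⟨ι, p, hι, hμ, hp, hker, hbr, hact, σ, φ, θ, hσ, hφs, hφ, hθs, hl⟩ := hX
  have hμι : ∀ w, X.μ (ι w) = 0 := fun w => (hμ _).1 ⟨w, rfl⟩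
  have hdS : ∀ a, S.diff a = 0 := fun a => by rw [hS]; rfl
  have hactσ : ∀ x w, X.act (σ x) (ι w) = ι (S.kerAct x w) := fun x w => by
    rw [hact, hσ]; rfl
  -- The target has trivial Jacobiator, so compatibility with Jacobiators says precisely that `ι l₃`
  -- is the differential of `φ + ι θ`, the last clause of `Realizes`.
  let F : Hom S X.toStrict.toSemistrict := Hom.ofParts (X.toObj ∘ₗ σ) (X.toKer ∘ₗ ι)
    ((φ + θ.compr₂ ι).compr₂ X.toKer)
    (fun a => by simp [diff_toKer, hμι, hdS])
    (fun x y => by simp [diff_toKer, hμι, hφ, brObj_toObj])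
    (fun x y => by
      simp only [LinearMap.compr₂_apply, LinearMap.add_apply]
      rw [hφs, hθs]
      simp
      abel)
    (fun x a => by simp [kerAct_toKer, hdS, hactσ])
    (fun x y z => by
      simp only [LinearMap.comp_apply, LinearMap.compr₂_apply, LinearMap.add_apply, kerAct_toKer,
        jacPart_toObj, S.jacPart_apply, hl, ceDifferential, map_add, map_sub, hactσ]
      rw [hφs x (S.brObj y z), hθs x (S.brObj y z)]
      simp only [map_neg]
      have : ∀ x w, S.kerAction x w = S.kerAct x w := fun _ _ => rfl
      simp only [this]
      abel)
  have hF : F.kerMap = X.toKer ∘ₗ ι := Hom.kerMap_ofParts _ _ _ _ _ _ _ _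
  obtain ⟨e, -⟩ := F.exists_equivalence_of_isSkeletal hS p
    (by
      ext g
      refine (hker g).trans ⟨fun ⟨h, hh⟩ => ⟨X.toKer h, by rw [diff_toKer, hh]; rfl⟩, ?_⟩
      rintro ⟨a, rfl⟩
      obtain ⟨h, rfl⟩ := X.toKer_surjective a
      exact ⟨h, (X.diff_toKer h).symm⟩)
    hσ
    (by
      rw [hF]
      exact X.toKer_injective.comp hι)
    (by
      rw [hF]
      intro a ha
      obtain ⟨h, rfl⟩ := X.toKer_surjective a
      obtain ⟨w, rfl⟩ := (hμ h).2 ((X.diff_toKer h).symm.trans ha)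
      exact ⟨w, rfl⟩)
  exact ⟨e⟩

end LieCrossedModule

/-! ### Realization of the triple from an exact cover -/

namespace LieThreeCocycle.ExactCover

open SemistrictLie2Algebra

/-- The crossed module of a cover on which the cocycle of `S` is exact realizes the triple of
`S`. -/
theorem realizes {K : Type u} [Field K] [CharZero K] {S : SemistrictLie2Algebra.{u, v} K}
    (hS : S.IsSkeletal) (E : ExactCover.{_, _, _, v} (S.lieThreeCocycle hS)) :
    E.crossedModule.Realizes S := by
  -- The correction `θ` is `0`, because the differential of `E.defect` is the cocycle itself and not
  -- merely cohomologous to it.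
  refine ⟨E.inlH, E.p, fun _ _ h => congrArg Prod.fst h, ?_,
    fun x => ⟨E.σ x, E.p_σ x⟩, ?_, E.p_lie, ?_, E.σ, E.defect, 0, E.p_σ, E.defect_skew,
    fun _ _ => rfl, fun _ _ => neg_zero.symm, fun x y z => ?_⟩
  · intro h
    refine ⟨?_, fun hh => ⟨E.fstH h, E.extH rfl (Eq.symm hh)⟩⟩
    rintro ⟨w, rfl⟩
    rfl
  · exact fun a => ⟨fun ha => ⟨E.mkH 0 a ha, rfl⟩, fun ⟨h, hh⟩ => hh ▸ E.p_sndH h⟩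
  · intro a w
    refine E.extH ?_ (@lie_zero E.G E.G _ _ _ a)
    change S.kerAct (E.p a) w + E.ω a 0 = S.kerAct (E.p a) w
    rw [map_zero, add_zero]
  · have h0 : ceDifferential (fun a b => S.brObj a b) S.kerAction
        (fun a b => (0 : S.Obj →ₗ[K] S.Obj →ₗ[K] LinearMap.ker S.src) a b) x y z = 0 := by
      simp [ceDifferential, ← kerAct_apply]
    have h1 := E.ceDifferential_defect x y z
    rw [← add_zero (ceDifferential _ _ _ _ _ _), ← map_zero E.inlH, ← h0] at h1
    exact h1.symm

end LieThreeCocycle.ExactCover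

/-! ### Calculus of vector-valued polynomials -/

section PolynomialPaths

open TensorProduct Polynomial

variable {K : Type*} [Field K]

/-- The antiderivative of a polynomial which vanishes at `0`. -/
noncomputable def Polynomial.antiderivative (K : Type*) [Field K] : K[X] →ₗ[K] K[X] :=
  (Polynomial.basisMonomials K).constr K fun n => monomial (n + 1) ((n + 1 : K)⁻¹)

theorem Polynomial.antiderivative_monomial (n : ℕ) (c : K) :
    antiderivative K (monomial n c) = monomial (n + 1) (c * (n + 1 : K)⁻¹) := by
  have h : antiderivative K (monomial n 1) = monomial (n + 1) ((n + 1 : K)⁻¹) := by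
    have := (Polynomial.basisMonomials K).constr_basis K
      (fun n : ℕ => (monomial (n + 1) ((n + 1 : K)⁻¹) : K[X])) n
    rwa [coe_basisMonomials] at this
  rw [← mul_one c, ← smul_eq_mul, ← smul_monomial, map_smul, h, smul_monomial, smul_eq_mul,
    smul_eq_mul, mul_one]

theorem Polynomial.eval_zero_antiderivative (a : K[X]) : (antiderivative K a).eval 0 = 0 := by
  have : (leval 0).comp (antiderivative K) = 0 :=
    Polynomial.lhom_ext' fun n => LinearMap.ext fun c => by
      simp [antiderivative_monomial]
  exact LinearMap.congr_fun this a

theorem Polynomial.derivative_antiderivative [CharZero K] (a : K[X]) :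
    derivative (antiderivative K a) = a := by
  have : derivative.comp (antiderivative K) = LinearMap.id :=
    Polynomial.lhom_ext' fun n => LinearMap.ext fun c => by
      have : (n + 1 : K) ≠ 0 := Nat.cast_add_one_ne_zero n
      simp [antiderivative_monomial, this]
  exact LinearMap.congr_fun this a

theorem Polynomial.antiderivative_derivative [CharZero K] (a : K[X]) :
    antiderivative K (derivative a) = a - C (a.eval 0) := by
  have : (antiderivative K).comp derivative = LinearMap.id - (monomial 0).comp (leval 0) :=
    Polynomial.lhom_ext' fun n => LinearMap.ext fun c => by
      cases n with
      | zero => simp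
      | succ n =>
        have : (n + 1 : K) ≠ 0 := Nat.cast_add_one_ne_zero n
        simp [antiderivative_monomial, this]
  exact LinearMap.congr_fun this a

variable {U V W : Type*} [AddCommGroup U] [Module K U] [AddCommGroup V] [Module K V]
  [AddCommGroup W] [Module K W]

/-- The extension of a bilinear map to vector-valued polynomials. -/
noncomputable def polyMap₂ (b : U →ₗ[K] V →ₗ[K] W) :
    K[X] ⊗[K] U →ₗ[K] K[X] ⊗[K] V →ₗ[K] K[X] ⊗[K] W :=
  TensorProduct.map₂ (LinearMap.mul K K[X]) b

@[simp] theorem polyMap₂_tmul (b : U →ₗ[K] V →ₗ[K] W) (p q : K[X]) (x : U) (y : V) :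
    polyMap₂ b (p ⊗ₜ x) (q ⊗ₜ y) = (p * q) ⊗ₜ b x y := rfl

/-- The derivative of a vector-valued polynomial. -/
noncomputable def polyDeriv (U : Type*) [AddCommGroup U] [Module K U] :
    K[X] ⊗[K] U →ₗ[K] K[X] ⊗[K] U := LinearMap.rTensor U derivative

@[simp] theorem polyDeriv_tmul (p : K[X]) (x : U) :
    polyDeriv U (p ⊗ₜ[K] x) = derivative p ⊗ₜ x := rfl

/-- The antiderivative of a vector-valued polynomial which vanishes at `0`. -/
noncomputable def polyInt (U : Type*) [AddCommGroup U] [Module K U] :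
    K[X] ⊗[K] U →ₗ[K] K[X] ⊗[K] U := LinearMap.rTensor U (antiderivative K)

@[simp] theorem polyInt_tmul (p : K[X]) (x : U) :
    polyInt U (p ⊗ₜ[K] x) = antiderivative K p ⊗ₜ x := rfl

/-- The value of a vector-valued polynomial. -/
noncomputable def polyEval (U : Type*) [AddCommGroup U] [Module K U] (t : K) :
    K[X] ⊗[K] U →ₗ[K] U := (TensorProduct.lid K U).toLinearMap ∘ₗ LinearMap.rTensor U (leval t)

@[simp] theorem polyEval_tmul (t : K) (p : K[X]) (x : U) :
    polyEval U t (p ⊗ₜ[K] x) = p.eval t • x := rfl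

theorem polyEval_polyMap₂ (b : U →ₗ[K] V →ₗ[K] W) (t : K) (ξ : K[X] ⊗[K] U) (η : K[X] ⊗[K] V) :
    polyEval W t (polyMap₂ b ξ η) = b (polyEval U t ξ) (polyEval V t η) := by
  induction ξ using TensorProduct.induction_on with
  | zero => simp
  | add ξ ξ' h h' => simp [h, h']
  | tmul p x =>
    induction η using TensorProduct.induction_on with
    | zero => simp
    | add η η' h h' => simp [h, h']
    | tmul q y => simp [mul_smul, smul_comm (q.eval t)]

theorem polyDeriv_polyMap₂ (b : U →ₗ[K] V →ₗ[K] W) (ξ : K[X] ⊗[K] U) (η : K[X] ⊗[K] V) :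
    polyDeriv W (polyMap₂ b ξ η) = polyMap₂ b (polyDeriv U ξ) η + polyMap₂ b ξ (polyDeriv V η) := by
  induction ξ using TensorProduct.induction_on with
  | zero => simp
  | add ξ ξ' h h' => simp [h, h']; abel
  | tmul p x =>
    induction η using TensorProduct.induction_on with
    | zero => simp
    | add η η' h h' => simp [h, h']; abel
    | tmul q y => simp [derivative_mul, add_tmul]

theorem polyEval_zero_polyInt (ξ : K[X] ⊗[K] U) : polyEval U 0 (polyInt U ξ) = 0 := by
  induction ξ using TensorProduct.induction_on with
  | zero => simp
  | add ξ ξ' h h' => simp [h, h']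
  | tmul p x => simp [eval_zero_antiderivative]

variable [CharZero K]

theorem polyDeriv_polyInt (ξ : K[X] ⊗[K] U) : polyDeriv U (polyInt U ξ) = ξ := by
  induction ξ using TensorProduct.induction_on with
  | zero => simp
  | add ξ ξ' h h' => simp [h, h']
  | tmul p x => simp [derivative_antiderivative]

theorem polyInt_polyDeriv (ξ : K[X] ⊗[K] U) (h0 : polyEval U 0 ξ = 0) :
    polyInt U (polyDeriv U ξ) = ξ := by
  have h : ∀ ξ, polyInt U (polyDeriv U ξ) = ξ - (1 : K[X]) ⊗ₜ polyEval U 0 ξ := fun ξ => by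
    induction ξ using TensorProduct.induction_on with
    | zero => simp
    | add ξ ξ' h h' => simp [h, h', tmul_add]; abel
    | tmul p x =>
      simp [antiderivative_derivative, sub_tmul]
      rw [smul_tmul', smul_eq_C_mul, mul_one]
  rw [h, h0, tmul_zero, sub_zero]

end PolynomialPaths

/-! ### Cartan calculus for polynomial paths -/

namespace LieThreeCocycle

open TensorProduct Polynomial

variable {K : Type*} [Field K] {g V : Type*} [AddCommGroup g] [Module K g] [AddCommGroup V]
  [Module K V] (T : LieThreeCocycle K g V)

/-- The pointwise bracket of paths in `g`. -/
noncomputable def pathBr : K[X] ⊗[K] g →ₗ[K] K[X] ⊗[K] g →ₗ[K] K[X] ⊗[K] g := polyMap₂ T.br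

/-- The pointwise action of paths in `g` on paths in `V`. -/
noncomputable def pathAct : K[X] ⊗[K] g →ₗ[K] K[X] ⊗[K] V →ₗ[K] K[X] ⊗[K] V := polyMap₂ T.act

/-- The pointwise evaluation of paths in `Hom(g, V)` at paths in `g`. -/
noncomputable def pathApp (K g V : Type*) [Field K] [AddCommGroup g] [Module K g] [AddCommGroup V]
    [Module K V] : K[X] ⊗[K] (g →ₗ[K] V) →ₗ[K] K[X] ⊗[K] g →ₗ[K] K[X] ⊗[K] V :=
  polyMap₂ LinearMap.id

/-- The action of `g` on `Hom(g, V)`. -/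
def homAct : g →ₗ[K] (g →ₗ[K] V) →ₗ[K] g →ₗ[K] V :=
  LinearMap.mk₂ K (fun x B => T.act x ∘ₗ B - B ∘ₗ T.br x) (fun x x' B => by ext; simp; abel)
    (fun t x B => by ext; simp [smul_sub]) (fun x B B' => by ext; simp; abel)
    (fun t x B => by ext; simp [smul_sub])

@[simp] theorem homAct_apply (x : g) (B : g →ₗ[K] V) (u : g) :
    T.homAct x B u = T.act x (B u) - B (T.br x u) := rfl

/-- The pointwise action of paths in `g` on paths in `Hom(g, V)`. -/
noncomputable def pathHomAct :
    K[X] ⊗[K] g →ₗ[K] K[X] ⊗[K] (g →ₗ[K] V) →ₗ[K] K[X] ⊗[K] (g →ₗ[K] V) := polyMap₂ T.homAct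

/-- The Chevalley-Eilenberg differential of paths in `V`. -/
noncomputable def pathDiff : K[X] ⊗[K] V →ₗ[K] K[X] ⊗[K] (g →ₗ[K] V) :=
  LinearMap.lTensor K[X] T.act.flip

/-- The pointwise contraction of the cocycle `c` with two paths. -/
noncomputable def pathC : K[X] ⊗[K] g →ₗ[K] K[X] ⊗[K] g →ₗ[K] K[X] ⊗[K] (g →ₗ[K] V) := polyMap₂ (-T.c)

section

variable (p q r : K[X]) (x y z : g) (w : V) (B : g →ₗ[K] V)

@[simp] theorem pathBr_tmul : T.pathBr (p ⊗ₜ x) (q ⊗ₜ y) = (p * q) ⊗ₜ T.br x y := rfl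

@[simp] theorem pathAct_tmul : T.pathAct (p ⊗ₜ x) (q ⊗ₜ w) = (p * q) ⊗ₜ T.act x w := rfl

@[simp] theorem pathApp_tmul : pathApp K g V (p ⊗ₜ B) (q ⊗ₜ x) = (p * q) ⊗ₜ B x := rfl

@[simp] theorem pathHomAct_tmul : T.pathHomAct (p ⊗ₜ x) (q ⊗ₜ B) = (p * q) ⊗ₜ T.homAct x B := rfl

@[simp] theorem pathDiff_tmul : T.pathDiff (p ⊗ₜ w) = p ⊗ₜ T.act.flip w := rfl

@[simp] theorem pathC_tmul : T.pathC (p ⊗ₜ x) (q ⊗ₜ y) = (p * q) ⊗ₜ (-T.c x y) := rfl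

end

theorem pathBr_skew (ξ η : K[X] ⊗[K] g) : T.pathBr ξ η = - T.pathBr η ξ := by
  induction ξ using TensorProduct.induction_on with
  | zero => simp
  | add ξ ξ' h h' => simp [h, h']; abel
  | tmul p x =>
    induction η using TensorProduct.induction_on with
    | zero => simp
    | add η η' h h' => simp [h, h']; abel
    | tmul q y => rw [pathBr_tmul, pathBr_tmul, T.br_skew, tmul_neg, mul_comm]

theorem pathC_skew (ξ η : K[X] ⊗[K] g) : T.pathC ξ η = - T.pathC η ξ := by
  induction ξ using TensorProduct.induction_on with
  | zero => simp
  | add ξ ξ' h h' => simp [h, h']; abel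
  | tmul p x =>
    induction η using TensorProduct.induction_on with
    | zero => simp
    | add η η' h h' => simp [h, h']; abel
    | tmul q y =>
      have : T.c x y = - T.c y x := LinearMap.ext fun z => T.c_left x y z
      rw [pathC_tmul, pathC_tmul, this, tmul_neg (p * q), mul_comm]

/-- To prove a trilinear identity for vector-valued polynomials it is enough to prove it for pure
tensors. -/
theorem trilinear_ext {U₁ U₂ U₃ W : Type*} [AddCommGroup U₁] [Module K U₁] [AddCommGroup U₂]
    [Module K U₂] [AddCommGroup U₃] [Module K U₃] [AddCommGroup W] [Module K W]
    (F : K[X] ⊗[K] U₁ → K[X] ⊗[K] U₂ → K[X] ⊗[K] U₃ → W)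
    (h₁ : ∀ ξ ξ' η ζ, F (ξ + ξ') η ζ = F ξ η ζ + F ξ' η ζ)
    (h₂ : ∀ ξ η η' ζ, F ξ (η + η') ζ = F ξ η ζ + F ξ η' ζ)
    (h₃ : ∀ ξ η ζ ζ', F ξ η (ζ + ζ') = F ξ η ζ + F ξ η ζ')
    (h : ∀ p x q y r z, F (p ⊗ₜ x) (q ⊗ₜ y) (r ⊗ₜ z) = 0) (ξ η ζ) : F ξ η ζ = 0 := by
  induction ξ using TensorProduct.induction_on with
  | zero => simpa using h₁ 0 0 η ζ
  | add ξ ξ' h h' => rw [h₁, h, h', add_zero]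
  | tmul p x =>
    induction η using TensorProduct.induction_on with
    | zero => simpa using h₂ (p ⊗ₜ x) 0 0 ζ
    | add ξ ξ' h h' => rw [h₂, h, h', add_zero]
    | tmul q y =>
      induction ζ using TensorProduct.induction_on with
      | zero => simpa using h₃ (p ⊗ₜ x) (q ⊗ₜ y) 0 0
      | add ξ ξ' h h' => rw [h₃, h, h', add_zero]
      | tmul r z => exact h p x q y r z

theorem pathBr_jacobi (ξ η ζ : K[X] ⊗[K] g) : T.pathBr (T.pathBr ξ η) ζ -
    (T.pathBr ξ (T.pathBr η ζ) + T.pathBr (T.pathBr ξ ζ) η) = 0 := by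
  refine trilinear_ext (fun ξ η ζ => T.pathBr (T.pathBr ξ η) ζ -
    (T.pathBr ξ (T.pathBr η ζ) + T.pathBr (T.pathBr ξ ζ) η)) ?_ ?_ ?_ ?_ ξ η ζ
  · intros; simp; abel
  · intros; simp; abel
  · intros; simp; abel
  · intro p x q y r z
    simp only [pathBr_tmul]
    rw [T.jacobi, tmul_add, ← mul_assoc, mul_right_comm p r q, sub_self]

theorem pathHomAct_pathBr (ξ η : K[X] ⊗[K] g) (B : K[X] ⊗[K] (g →ₗ[K] V)) :
    T.pathHomAct (T.pathBr ξ η) B -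
      (T.pathHomAct ξ (T.pathHomAct η B) - T.pathHomAct η (T.pathHomAct ξ B)) = 0 := by
  refine trilinear_ext (fun ξ η B => T.pathHomAct (T.pathBr ξ η) B -
      (T.pathHomAct ξ (T.pathHomAct η B) - T.pathHomAct η (T.pathHomAct ξ B))) ?_ ?_ ?_ ?_ ξ η B
  · intros; simp; abel
  · intros; simp; abel
  · intros; simp; abel
  · intro p x q y r B
    have : T.homAct (T.br x y) B = T.homAct x (T.homAct y B) - T.homAct y (T.homAct x B) := by
      ext u
      simp [T.act_br, T.jacobi x y u]
      rw [T.br_skew (T.br x u) y, map_neg]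
      abel
    simp only [pathHomAct_tmul, pathBr_tmul]
    rw [this, tmul_sub, ← mul_assoc, ← mul_assoc, mul_comm q p, sub_self]

/-- The Lie derivative commutes with the Chevalley-Eilenberg differential. -/
theorem pathHomAct_pathDiff (ξ : K[X] ⊗[K] g) (w : K[X] ⊗[K] V) :
    T.pathHomAct ξ (T.pathDiff w) = T.pathDiff (T.pathAct ξ w) := by
  induction ξ using TensorProduct.induction_on with
  | zero => simp
  | add ξ ξ' h h' => simp [h, h']
  | tmul p x =>
    induction w using TensorProduct.induction_on with
    | zero => simp
    | add η η' h h' => simp [h, h']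
    | tmul q w =>
      simp only [pathHomAct_tmul, pathDiff_tmul, pathAct_tmul]
      congr 1
      ext u
      simp [T.act_br]

theorem pathApp_pathDiff (w : K[X] ⊗[K] V) (ξ : K[X] ⊗[K] g) :
    pathApp K g V (T.pathDiff w) ξ = T.pathAct ξ w := by
  induction ξ using TensorProduct.induction_on with
  | zero => simp
  | add ξ ξ' h h' => simp [h, h']
  | tmul p x =>
    induction w using TensorProduct.induction_on with
    | zero => simp
    | add η η' h h' => simp [h, h']
    | tmul q w => simp [mul_comm]

theorem pathApp_pathHomAct (B : K[X] ⊗[K] (g →ₗ[K] V)) (η ξ : K[X] ⊗[K] g) :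
    pathApp K g V (T.pathHomAct η B) ξ - (T.pathAct η (pathApp K g V B ξ)
      - pathApp K g V B (T.pathBr η ξ)) = 0 := by
  refine trilinear_ext (fun B η ξ => pathApp K g V (T.pathHomAct η B) ξ -
    (T.pathAct η (pathApp K g V B ξ) - pathApp K g V B (T.pathBr η ξ))) ?_ ?_ ?_ ?_ B η ξ
  · intros; simp; abel
  · intros; simp; abel
  · intros; simp; abel
  · intro p B q y r x
    simp [tmul_sub, mul_comm, mul_left_comm]

theorem pathApp_pathC_left (ξ η ζ : K[X] ⊗[K] g) :
    pathApp K g V (T.pathC ξ η) ζ - pathApp K g V (T.pathC η ζ) ξ = 0 := by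
  refine trilinear_ext (fun ξ η ζ => pathApp K g V (T.pathC ξ η) ζ -
    pathApp K g V (T.pathC η ζ) ξ) ?_ ?_ ?_ ?_ ξ η ζ
  · intros; simp; abel
  · intros; simp; abel
  · intros; simp; abel
  · intro p x q y r z
    simp only [pathApp_tmul, pathC_tmul, LinearMap.neg_apply]
    rw [T.c_left x y z, T.c_right y x z, neg_neg, mul_comm (q * r), mul_assoc, sub_self]

/-- The cocycle identity of `c` with one argument left free: for the pointwise action, `-c(ξ, η, ·)`
fails to be a `2`-cocycle with values in `Hom(g, V)` by the differential of the function `-c(ξ, η,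
ζ)`. -/
theorem pathC_cocycle (ξ η ζ : K[X] ⊗[K] g) :
    T.pathHomAct ξ (T.pathC η ζ) - T.pathHomAct η (T.pathC ξ ζ) + T.pathHomAct ζ (T.pathC ξ η)
      - T.pathC (T.pathBr ξ η) ζ + T.pathC (T.pathBr ξ ζ) η - T.pathC (T.pathBr η ζ) ξ
      - T.pathDiff (pathApp K g V (T.pathC ξ η) ζ) = 0 := by
  refine trilinear_ext (fun ξ η ζ => T.pathHomAct ξ (T.pathC η ζ) - T.pathHomAct η (T.pathC ξ ζ)
    + T.pathHomAct ζ (T.pathC ξ η) - T.pathC (T.pathBr ξ η) ζ + T.pathC (T.pathBr ξ ζ) η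
    - T.pathC (T.pathBr η ζ) ξ - T.pathDiff (pathApp K g V (T.pathC ξ η) ζ)) ?_ ?_ ?_ ?_ ξ η ζ
  · intros; simp; abel
  · intros; simp; abel
  · intros; simp; abel
  · intro p x q y r z
    -- On pure tensors all terms share the polynomial factor `p * q * r`, so the identity reduces to
    -- one in `Hom(g, V)`.
    have h : T.homAct x (-T.c y z) - T.homAct y (-T.c x z) + T.homAct z (-T.c x y)
        - -T.c (T.br x y) z + -T.c (T.br x z) y - -T.c (T.br y z) x
        - T.act.flip (-T.c x y z) = 0 := by
      ext u
      have h := T.cocycle u x y z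
      have hc : ∀ a b d, T.c a b d = T.c b d a := fun a b d => by
        rw [T.c_left, T.c_right, neg_neg]
      rw [hc u y z, hc u x z, hc u x y, hc (T.br u x) y z, hc (T.br u y) x z, hc (T.br u z) x y,
        T.br_skew u x, T.br_skew u y, T.br_skew u z, T.c_right (T.br x y) u z,
        T.c_right (T.br x z) u y, T.c_right (T.br y z) u x] at h
      simp at h ⊢
      linear_combination (norm := module) h
    simp only [pathHomAct_tmul, pathC_tmul, pathBr_tmul, pathApp_tmul, pathDiff_tmul]
    rw [show p * (q * r) = p * q * r by ring, show q * (p * r) = p * q * r by ring,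
      show r * (p * q) = p * q * r by ring, show p * r * q = p * q * r by ring,
      show q * r * p = p * q * r by ring]
    simp only [← tmul_sub, ← tmul_add]
    exact (congrArg _ h).trans (tmul_zero _ _)

end LieThreeCocycle

/-! ### The path extension and the exact cover -/

namespace LieThreeCocycle

open TensorProduct Polynomial

variable {K : Type*} [Field K] {g V : Type*} [AddCommGroup g] [Module K g] [AddCommGroup V]
  [Module K V] (T : LieThreeCocycle K g V)

/-- The antiderivative of the contraction of a path in `Hom(g, V)` with the derivative of a path
in `g`. -/
noncomputable def pathInt (K g V : Type*) [Field K] [AddCommGroup g] [Module K g] [AddCommGroup V]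
    [Module K V] : K[X] ⊗[K] g →ₗ[K] K[X] ⊗[K] (g →ₗ[K] V) →ₗ[K] K[X] ⊗[K] V :=
  ((pathApp K g V).flip ∘ₗ polyDeriv g).compr₂ (polyInt V)

theorem pathInt_apply (ξ : K[X] ⊗[K] g) (B : K[X] ⊗[K] (g →ₗ[K] V)) :
    pathInt K g V ξ B = polyInt V (pathApp K g V B (polyDeriv g ξ)) := rfl

/-- The action of paths in `g` on paths in `Hom(g, V)`, modified by a homotopy. -/
noncomputable def pathStar :
    K[X] ⊗[K] g →ₗ[K] K[X] ⊗[K] (g →ₗ[K] V) →ₗ[K] K[X] ⊗[K] (g →ₗ[K] V) :=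
  LinearMap.mk₂ K (fun ξ B => T.pathHomAct ξ B - T.pathDiff (pathInt K g V ξ B))
    (fun ξ ξ' B => by simp only [map_add, LinearMap.add_apply]; abel)
    (fun t ξ B => by simp only [map_smul, LinearMap.smul_apply, smul_sub])
    (fun ξ B B' => by simp only [map_add]; abel)
    (fun t ξ B => by simp only [map_smul, smul_sub])

theorem pathStar_apply (ξ : K[X] ⊗[K] g) (B : K[X] ⊗[K] (g →ₗ[K] V)) :
    T.pathStar ξ B = T.pathHomAct ξ B - T.pathDiff (pathInt K g V ξ B) := rfl

section

variable [CharZero K]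

/-- Integration by parts; the boundary term at `0` vanishes because antiderivatives vanish there. -/
theorem polyInt_pathAct (ξ : K[X] ⊗[K] g) (w : K[X] ⊗[K] V) :
    polyInt V (T.pathAct (polyDeriv g ξ) (polyInt V w)) =
      T.pathAct ξ (polyInt V w) - polyInt V (T.pathAct ξ w) := by
  have h := polyInt_polyDeriv (T.pathAct ξ (polyInt V w)) (by
    rw [pathAct, polyEval_polyMap₂, polyEval_zero_polyInt, map_zero])
  rw [pathAct, polyDeriv_polyMap₂, polyDeriv_polyInt, map_add] at h
  exact eq_sub_of_add_eq h

/-- This is the `V` component of the statement that `ξ · (w, B) = (ξ w + pathInt ξ B, pathStar ξ B)`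
respects brackets. Integrating the correction term of `pathStar` by parts leaves a part symmetric in
`ξ` and `η`, which cancels, and the contraction of `B` with the derivative of `[ξ, η]`. -/
theorem pathInt_pathBr (ξ η : K[X] ⊗[K] g) (B : K[X] ⊗[K] (g →ₗ[K] V)) :
    pathInt K g V (T.pathBr ξ η) B = T.pathAct ξ (pathInt K g V η B)
      + pathInt K g V ξ (T.pathStar η B)
      - (T.pathAct η (pathInt K g V ξ B) + pathInt K g V η (T.pathStar ξ B)) := by
  have h1 : polyDeriv g (T.pathBr ξ η) =
      T.pathBr (polyDeriv g ξ) η + T.pathBr ξ (polyDeriv g η) := polyDeriv_polyMap₂ _ _ _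
  have h2 : ∀ B η ξ, pathApp K g V (T.pathHomAct η B) ξ = T.pathAct η (pathApp K g V B ξ)
      - pathApp K g V B (T.pathBr η ξ) := fun B η ξ => sub_eq_zero.1 (T.pathApp_pathHomAct B η ξ)
  rw [pathInt_apply, pathInt_apply, pathInt_apply, pathInt_apply, pathInt_apply, h1,
    T.pathBr_skew _ η, pathStar_apply, pathStar_apply]
  simp only [map_add, map_sub, LinearMap.sub_apply, h2, T.pathApp_pathDiff, pathInt_apply,
    polyInt_pathAct, map_neg]
  abel

/-- Apply `pathDiff` to `pathInt_pathBr`. Since it intertwines the pointwise actions, subtracting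
`pathDiff` of `pathInt` again gives an action. -/
theorem pathStar_pathBr (ξ η : K[X] ⊗[K] g) (B : K[X] ⊗[K] (g →ₗ[K] V)) :
    T.pathStar (T.pathBr ξ η) B =
      T.pathStar ξ (T.pathStar η B) - T.pathStar η (T.pathStar ξ B) := by
  have h1 := T.pathHomAct_pathBr ξ η B
  have h2 := congrArg T.pathDiff (T.pathInt_pathBr ξ η B)
  rw [T.pathStar_apply (T.pathBr ξ η), h2, T.pathStar_apply ξ (T.pathStar η B),
    T.pathStar_apply η (T.pathStar ξ B)]
  simp only [map_add, map_sub, T.pathStar_apply, T.pathHomAct_pathDiff] at h1 ⊢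
  linear_combination (norm := module) h1

/-- The contractions of the cocycle satisfy the fundamental theorem of calculus. -/
theorem pathInt_pathC (ξ η ζ : K[X] ⊗[K] g) (h : polyEval g (0 : K) ξ = 0) :
    pathInt K g V ξ (T.pathC η ζ) - pathInt K g V η (T.pathC ξ ζ) + pathInt K g V ζ (T.pathC ξ η)
      = pathApp K g V (T.pathC ξ η) ζ := by
  have hc : ∀ ξ η ζ, pathApp K g V (T.pathC ξ η) ζ = pathApp K g V (T.pathC η ζ) ξ :=
    fun ξ η ζ => sub_eq_zero.1 (T.pathApp_pathC_left ξ η ζ)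
  have h1 := polyInt_polyDeriv (pathApp K g V (T.pathC ξ η) ζ) (by
    rw [pathApp, polyEval_polyMap₂, pathC, polyEval_polyMap₂, h]
    simp)
  have h2 : polyDeriv V (pathApp K g V (T.pathC ξ η) ζ) =
      pathApp K g V (T.pathC (polyDeriv g ξ) η + T.pathC ξ (polyDeriv g η)) ζ +
        pathApp K g V (T.pathC ξ η) (polyDeriv g ζ) := by
    rw [pathApp, polyDeriv_polyMap₂, pathC, polyDeriv_polyMap₂]
  rw [h2, map_add, map_add, LinearMap.add_apply, map_add, hc (polyDeriv g ξ),
    ← hc ζ ξ (polyDeriv g η), T.pathC_skew ζ ξ] at h1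
  rw [pathInt_apply, pathInt_apply, pathInt_apply]
  simp only [map_neg, LinearMap.neg_apply] at h1
  linear_combination (norm := module) h1

/-- The modification of the action is made for this. By the fundamental theorem of calculus its
three correction terms add up to the differential of `-c(ξ, η, ζ)`, the defect found in
`pathC_cocycle`. -/
theorem pathStar_pathC (ξ η ζ : K[X] ⊗[K] g) (h : polyEval g (0 : K) ξ = 0) :
    T.pathStar ξ (T.pathC η ζ) - T.pathStar η (T.pathC ξ ζ) + T.pathStar ζ (T.pathC ξ η)
      - T.pathC (T.pathBr ξ η) ζ + T.pathC (T.pathBr ξ ζ) η - T.pathC (T.pathBr η ζ) ξ = 0 := by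
  have h1 := T.pathC_cocycle ξ η ζ
  rw [← T.pathInt_pathC ξ η ζ h] at h1
  simp only [pathStar_apply, map_add, map_sub] at h1 ⊢
  linear_combination (norm := module) h1

end

/-- The extension of the Lie algebra of paths in `g` which start at `0` by paths in `Hom(g, V)`
with cocycle `T.pathC`. -/
@[nolint unusedArguments]
def PathExtension (_T : LieThreeCocycle K g V) : Type _ :=
  K[X] ⊗[K] (g →ₗ[K] V) × LinearMap.ker (polyEval (K := K) g 0)

namespace PathExtension

noncomputable instance : AddCommGroup T.PathExtension :=
  inferInstanceAs (AddCommGroup (K[X] ⊗[K] (g →ₗ[K] V) × LinearMap.ker (polyEval (K := K) g 0)))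

noncomputable instance : Module K T.PathExtension :=
  inferInstanceAs (Module K (K[X] ⊗[K] (g →ₗ[K] V) × LinearMap.ker (polyEval (K := K) g 0)))

/-- The component in the kernel of the extension. -/
noncomputable def fst : T.PathExtension →ₗ[K] K[X] ⊗[K] (g →ₗ[K] V) :=
  LinearMap.fst K (K[X] ⊗[K] (g →ₗ[K] V)) (LinearMap.ker (polyEval (K := K) g 0))

/-- The path in `g` of an element of the extension. -/
noncomputable def snd : T.PathExtension →ₗ[K] K[X] ⊗[K] g :=
  (LinearMap.ker (polyEval (K := K) g 0)).subtype ∘ₗ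
    LinearMap.snd K (K[X] ⊗[K] (g →ₗ[K] V)) (LinearMap.ker (polyEval (K := K) g 0))

/-- The element `(B, ξ)`. -/
def mk (B : K[X] ⊗[K] (g →ₗ[K] V)) (ξ : K[X] ⊗[K] g) (hξ : polyEval g (0 : K) ξ = 0) :
    T.PathExtension := (B, ⟨ξ, hξ⟩)

@[simp] theorem fst_mk (B : K[X] ⊗[K] (g →ₗ[K] V)) (ξ : K[X] ⊗[K] g) (hξ : polyEval g (0 : K) ξ = 0) :
    fst T (mk T B ξ hξ) = B := rfl

@[simp] theorem snd_mk (B : K[X] ⊗[K] (g →ₗ[K] V)) (ξ : K[X] ⊗[K] g) (hξ : polyEval g (0 : K) ξ = 0) :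
    snd T (mk T B ξ hξ) = ξ := rfl

@[simp] theorem eval_snd (a : T.PathExtension) : polyEval g (0 : K) (snd T a) = 0 := a.2.2

theorem ext' {a b : T.PathExtension} (h : fst T a = fst T b) (h' : snd T a = snd T b) : a = b :=
  Prod.ext h (Subtype.ext h')

noncomputable instance : Bracket T.PathExtension T.PathExtension where
  bracket a b := mk T
    (T.pathStar (snd T a) (fst T b) - T.pathStar (snd T b) (fst T a) + T.pathC (snd T a) (snd T b))
    (T.pathBr (snd T a) (snd T b)) (by rw [pathBr, polyEval_polyMap₂]; simp)

@[simp] theorem fst_lie (a b : T.PathExtension) : fst T ⁅a, b⁆ =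
    T.pathStar (snd T a) (fst T b) - T.pathStar (snd T b) (fst T a)
      + T.pathC (snd T a) (snd T b) := rfl

@[simp] theorem snd_lie (a b : T.PathExtension) : snd T ⁅a, b⁆ = T.pathBr (snd T a) (snd T b) := rfl

variable [CharZero K]

noncomputable instance : LieRing T.PathExtension where
  add_lie a b c := ext' T (by simp; abel) (by simp)
  lie_add a b c := ext' T (by simp; abel) (by simp)
  lie_self a := ext' T
    (by simpa using eq_zero_of_eq_neg_self K (T.pathC_skew (snd T a) (snd T a)))
    (by simpa using eq_zero_of_eq_neg_self K (T.pathBr_skew (snd T a) (snd T a)))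
  leibniz_lie a b c := ext' T
    (by
      have h := T.pathStar_pathC (snd T a) (snd T b) (snd T c) (eval_snd T a)
      simp only [fst_lie, snd_lie, map_add, map_sub, T.pathStar_pathBr]
      rw [T.pathC_skew (snd T a) (T.pathBr _ _), T.pathC_skew (snd T b) (T.pathBr _ _)]
      linear_combination (norm := module) h)
    (by
      have h := T.pathBr_jacobi (snd T a) (snd T b) (snd T c)
      simp only [snd_lie, map_add]
      rw [T.pathBr_skew (snd T b) (T.pathBr _ _)]
      linear_combination (norm := module) -h)

noncomputable instance : LieAlgebra K T.PathExtension where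
  lie_smul t a b := ext' T (by simp [smul_sub]) (by simp)

end PathExtension

/-- The cocycle becomes exact on the extension `T.PathExtension` of the Lie algebra of paths. -/
noncomputable def pathCover [CharZero K] : T.ExactCover where
  G := T.PathExtension
  p := polyEval g (1 : K) ∘ₗ PathExtension.snd T
  p_lie a b := polyEval_polyMap₂ _ _ _ _
  σ :=
    -- The section sends `x` to the straight path `t ↦ t x`.
    { toFun := fun x => PathExtension.mk T 0 (X ⊗ₜ x) (by simp)
      map_add' := fun x y => PathExtension.ext' T (by simp) (by simp [tmul_add])
      map_smul' := fun t x => PathExtension.ext' T (by simp) (by simp) }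
  p_σ x := by simp
  -- For `a = (B, ξ)` and `b = (B', η)` this is the integral over `[0,1]` of `B'(ξ') - B(η')`.
  ω := LinearMap.mk₂ K
    (fun a b => polyEval V (1 : K) (pathInt K g V (PathExtension.snd T a) (PathExtension.fst T b)
      - pathInt K g V (PathExtension.snd T b) (PathExtension.fst T a)))
    (fun a a' b => by simp; abel) (fun t a b => by simp [smul_sub])
    (fun a a' b => by simp; abel) (fun t a b => by simp [smul_sub])
  ω_skew a b := by simp
  d_ω a b c := by
    -- In `dω` the terms containing the `Hom(g, V)` components cancel by `pathInt_pathBr`. The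
    -- contributions of `pathC` to the brackets remain, and the fundamental theorem evaluates their
    -- sum at `t = 1`.
    have h := congrArg (polyEval V (1 : K)) (T.pathInt_pathC (PathExtension.snd T a)
      (PathExtension.snd T b) (PathExtension.snd T c) (PathExtension.eval_snd T a))
    have h1 : ∀ ξ w, T.act (polyEval g (1 : K) ξ) (polyEval V (1 : K) w) = polyEval V (1 : K) (T.pathAct ξ w) :=
      fun ξ w => (polyEval_polyMap₂ _ _ _ _).symm
    have h2 : polyEval V (1 : K) (pathApp K g V (T.pathC (PathExtension.snd T a)
        (PathExtension.snd T b)) (PathExtension.snd T c)) =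
          - T.c (polyEval g (1 : K) (PathExtension.snd T a)) (polyEval g (1 : K) (PathExtension.snd T b))
            (polyEval g (1 : K) (PathExtension.snd T c)) := by
      rw [pathApp, polyEval_polyMap₂, pathC, polyEval_polyMap₂]
      rfl
    rw [h2] at h
    simp only [LinearMap.mk₂_apply, LinearMap.comp_apply, PathExtension.fst_lie,
      PathExtension.snd_lie, map_sub, map_add, h1, T.pathInt_pathBr] at h ⊢
    linear_combination (norm := module) h

end LieThreeCocycle

/-- The universe `max u v` makes room for the crossed module, whose path spaces are tensor products
with `K[X]`. Strictification follows from the other two claims, applied to any skeletal model and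
any crossed module realizing its triple. -/
theorem mainTheorem5 (K : Type u) [Field K] [CharZero K]
    (L : SemistrictLie2Algebra.{u, max u v} K) :
    (∃ M : StrictLie2Algebra.{u, max u v} K,
      Nonempty (Bicategory.Equivalence L M.toSemistrict)) ∧
    (∃ S : SemistrictLie2Algebra.{u, max u v} K, S.IsSkeletalModel L) ∧
    (∀ S : SemistrictLie2Algebra.{u, max u v} K, S.IsSkeletalModel L →
      (∃ X : LieCrossedModule.{u, max u v} K, X.Realizes S) ∧
      ∀ X : LieCrossedModule.{u, max u v} K, X.Realizes S →
        Nonempty (Bicategory.Equivalence L X.toStrict.toSemistrict)) := by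
  have hL := L.exists_isSkeletalModel
  have h : ∀ S : SemistrictLie2Algebra.{u, max u v} K, S.IsSkeletalModel L →
      (∃ X : LieCrossedModule.{u, max u v} K, X.Realizes S) ∧
      ∀ X : LieCrossedModule.{u, max u v} K, X.Realizes S →
        Nonempty (Bicategory.Equivalence L X.toStrict.toSemistrict) := by
    rintro S ⟨hS, e, -⟩
    refine ⟨⟨_, (S.lieThreeCocycle hS).pathCover.realizes hS⟩, fun X hX => ?_⟩
    obtain ⟨e'⟩ := e.nonempty_symm
    obtain ⟨e''⟩ := hX.nonempty_equivalence hS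
    exact e'.nonempty_trans e''
  obtain ⟨S, hS⟩ := hL
  obtain ⟨⟨X, hX⟩, h'⟩ := h S hS
  exact ⟨⟨X.toStrict, h' X hX⟩, ⟨S, hS⟩, h⟩
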